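/- Let $m\ge 1$, $\theta=(\theta_1,\dots,\theta_m)\in\mathbb{R}^m$, $\gamma=(\gamma_1,\dots,\gamma_m)\in\mathbb{R}^m$, and let $$\mathcal{C}(\theta,\gamma)=\int_{\mathcal{S}^{m-1}}\exp\Big(\sum_{i=1}^m(-\theta_i x_i^2+\gamma_i x_i)\Big)\,\mathrm{d}_{\mathcal{S}^{m-1}}(x)$$ be the normalizing constant of the Fisher--Bingham distribution, where $\mathrm{d}_{\mathcal{S}^{m-1}}$ is the (unnormalized) surface measure on the unit sphere $\mathcal{S}^{m-1}\subset\mathbb{R}^m$. Let $t_0\in\mathbb{R}$ with $t_0<\min_i\theta_i$. Let $0<\omega_d\le 1\le\omega_u$ with $\omega_d/\omega_u\le 1/2$, and let $0<d\le\min_i|\theta_i-t_0|$. For integers $N\ge \dfrac{2d(\omega_d+\omega_u)\omega_u^2}{\pi\omega_d^2}$ put $$h=\sqrt{\frac{2\pi d(\omega_d+\omega_u)}{\omega_d^2N}},\qquad p=\sqrt{\frac{Nh}{\omega_d}},\qquad q=\sqrt{\frac{\omega_dNh}{4}},$$ $$w(x;p,q)=\tfrac12\,\mathrm{erfc}\Big(\frac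 xp-q\Big),\qquad \mathcal{A}(t;\theta,\gamma)=\prod_{i=1}^m\frac{\exp\big(\frac{\gamma_i^2}{4(\theta_i-\mathrm{i}t-t_0)}\big)}{\sqrt{\theta_i-\mathrm{i}t-t_0}}$$ (principal branch of the square root, $\mathrm{erfc}(x)=\frac{2}{\sqrt\pi}\int_x^\infty e^{-s^2}\,\mathrm{d}s$), and $$\mathcal{C}_w^{(N,h)}(\theta,\gamma)=\pi^{\frac m2-1}e^{-t_0}\,h\sum_{n=-N-1}^{N}w(|nh|;p,q)\,\mathcal{A}(nh;\theta,\gamma)\,e^{-\mathrm{i}nh}.$$ Then there is a polynomial $\mathrm{Poly}$, which does not depend on $N$ (but may depend on all the other parameters $m,\theta,\gamma,t_0,\omega_d,\omega_u,d$), such that for all integers $N$ as above $$\big|\mathcal{C}(\theta,\gamma)-\mathcal{C}_w^{(N,h)}(\theta,\gamma)\big|\le \mathrm{Poly}(N)\,\exp\left(-\sqrt{\frac{\pi d\,\omega_d^2N}{2(\omega_d+\omega_u)}}\right).$$ -/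

import Mathlib

open MeasureTheory

namespace FisherBingham

noncomputable section

/-- The normalizing constant `C(θ, γ) = ∫ exp (∑ i, (-θ i * x i ^ 2 + γ i * x i))` of the
Fisher--Bingham distribution: an integral over the unit sphere of `ℝ^m` with respect to the
(unnormalized) surface measure. -/
def normConst {m : ℕ} (θ γ : Fin m → ℝ) : ℝ :=
  ∫ x : Metric.sphere (0 : EuclideanSpace ℝ (Fin m)) 1,
    Real.exp (∑ i, (-θ i * (x : EuclideanSpace ℝ (Fin m)) i ^ 2
      + γ i * (x : EuclideanSpace ℝ (Fin m)) i))
    ∂(volume : Measure (EuclideanSpace ℝ (Fin m))).toSphere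

/-- `A(t; θ, γ) = ∏ i, exp (γ i ^ 2 / (4 (θ i - I t - t₀))) / √(θ i - I t - t₀)`, with the principal
branch of the square root. -/
def amplitude {m : ℕ} (θ γ : Fin m → ℝ) (t₀ t : ℝ) : ℂ :=
  ∏ i, Complex.exp ((γ i : ℂ) ^ 2 / (4 * ((θ i : ℂ) - Complex.I * t - t₀)))
    / ((θ i : ℂ) - Complex.I * t - t₀) ^ (1 / 2 : ℂ)

/-- The complementary error function. -/
def erfc (x : ℝ) : ℝ :=
  2 / Real.sqrt Real.pi * ∫ s in Set.Ioi x, Real.exp (-s ^ 2)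

/-- The window function `w(x; p, q) = erfc (x / p - q) / 2`. -/
def window (x p q : ℝ) : ℝ := 1 / 2 * erfc (x / p - q)

/-- The mesh size `h`. -/
def stepSize (ωd ωu d : ℝ) (N : ℕ) : ℝ :=
  Real.sqrt (2 * Real.pi * d * (ωd + ωu) / (ωd ^ 2 * N))

/-- The window parameter `p`. -/
def windowP (ωd h : ℝ) (N : ℕ) : ℝ := Real.sqrt (N * h / ωd)

/-- The window parameter `q`. -/
def windowQ (ωd h : ℝ) (N : ℕ) : ℝ := Real.sqrt (ωd * N * h / 4)

/-- The truncated trapezoidal sum with the continuous Euler transform, with a general mesh size `h`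
and general window parameters `p`, `q`. -/
def eulerSum {m : ℕ} (θ γ : Fin m → ℝ) (t₀ h p q : ℝ) (N : ℕ) : ℂ :=
  ((Real.pi ^ ((m : ℝ) / 2 - 1) * Real.exp (-t₀) * h : ℝ) : ℂ) *
    ∑ n ∈ Finset.Icc (-(N : ℤ) - 1) (N : ℤ),
      ((window |(n : ℝ) * h| p q : ℝ) : ℂ) * amplitude θ γ t₀ ((n : ℝ) * h)
        * Complex.exp (-Complex.I * ((n : ℝ) * h : ℝ))

end

end FisherBingham

/-!
Write `A` for the amplitude and `W(t) = erfc (t / p - q) / 2 - erfc (t / p + q) / 2` for the smooth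
window, an entire even function that agrees with `w(|t|; p, q)` on the real line up to a term of
size `exp (-q ^ 2)`. With `R = π d / h`, which is the exponent to be reached, the choice of
parameters gives `q ^ 2 = (ωd + ωu) / (2 ωd) * R ≥ 3 / 2 * R`, so that factors `exp (-q ^ 2)` may
even be weakened to `exp (-2 q ^ 2 / 3)`.

*Representation.* In polar coordinates `A(t)` is, up to a power of `π`, the Fourier transform of the
density of `‖x‖ ^ 2` under the Gaussian weight `exp (∑ i, (-(θ i - t₀) * x i ^ 2 + γ i * x i))`, and
the value of this density at `1` is a multiple of the normalizing constant. Fourier inversion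
therefore says `C = π ^ (m / 2 - 1) * exp (-t₀) * ∫ A(t) exp (-I t) dt`. The integral is not
absolutely convergent for `m ≤ 2`. It is moved to a hyperbola in the lower half-plane, the image of
a horizontal line under `z ↦ d * sinh z`, where `exp (-I t)` decays; the inversion formula is
proved with a Gaussian convergence factor, which is removed after the deformation
(`integral_eq_contourIntegral`, `contourIntegral_one`).

*Error.* It has three parts.
* Inserting `W` into the contour integral: on the hyperbola `1 - W` is of size `exp (-q ^ 2)` near
  the origin, and further out the decay of `exp (-I t)` compensates for its growth
  (`norm_one_sub_smoothWindow_contour_le`).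
* The trapezoidal rule on the real line for `W(t) A(t) exp (-I t)`, which is holomorphic for
  `|Im t| ≤ d / 2`: Poisson summation bounds the error by a multiple of `exp (-2π (d / 2) / h)`
  (`norm_trapezoidal_sub_integral_le`).
* Passing from the full sum with `W` to the truncated sum with `w`
  (`norm_sum_window_sub_tsum_le`), where `N h = 2 p q` makes the tail of size `exp (-q ^ 2)`.

All other factors are polynomial in `N` (`exists_polynomial_bound`).
-/

namespace FisherBingham

open Complex Filter Topology Set

/-! ### Functions dominated by `M / (1 + x ^ 2)` on a horizontal strip -/

theorem integrable_div_one_add_sq (M : ℝ) : Integrable fun x : ℝ => M / (1 + x ^ 2) := by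
  simpa [div_eq_mul_inv] using integrable_inv_one_add_sq.const_mul M

theorem integral_div_one_add_sq (M : ℝ) : ∫ x : ℝ, M / (1 + x ^ 2) = Real.pi * M := by
  simp only [div_eq_mul_inv]
  rw [integral_const_mul, integral_univ_inv_one_add_sq, mul_comm]

theorem tendsto_div_one_add_sq (M : ℝ) :
    Tendsto (fun x : ℝ => M / (1 + x ^ 2)) atTop (𝓝 0) := by
  refine Tendsto.div_atTop tendsto_const_nhds ?_
  exact tendsto_atTop_add_const_left _ _ (tendsto_pow_atTop two_ne_zero)

theorem integrable_of_norm_le_div_one_add_sq {f : ℝ → ℂ} {M : ℝ} (hf : Continuous f)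
    (hM : ∀ x, ‖f x‖ ≤ M / (1 + x ^ 2)) : Integrable f :=
  (integrable_div_one_add_sq M).mono' hf.aestronglyMeasurable (Eventually.of_forall hM)

theorem norm_integral_le_of_norm_le_div_one_add_sq {f : ℝ → ℂ} {M : ℝ}
    (hM : ∀ x, ‖f x‖ ≤ M / (1 + x ^ 2)) : ‖∫ x, f x‖ ≤ Real.pi * M :=
  (norm_integral_le_of_norm_le (integrable_div_one_add_sq M) (Eventually.of_forall hM)).trans
    (integral_div_one_add_sq M).le

theorem continuous_on_line {f : ℂ → ℂ} {y : ℝ} (hf : ∀ x : ℝ, DifferentiableAt ℂ f (x + y * I)) :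
    Continuous fun x : ℝ => f (x + y * I) := by
  refine continuous_iff_continuousAt.2 fun x => ?_
  exact ContinuousAt.comp (f := fun x : ℝ => (x + y * I : ℂ)) (hf x).continuousAt (by fun_prop)

/-- Cauchy's theorem for a horizontal strip: the ends of the rectangles contribute nothing in the
limit, because the integrand is dominated by `M / (1 + x ^ 2)`. -/
theorem integral_line_eq_of_strip {f : ℂ → ℂ} {a b M : ℝ} (hab : a ≤ b)
    (hf : ∀ x y : ℝ, y ∈ Icc a b → DifferentiableAt ℂ f (x + y * I))
    (hM : ∀ x y : ℝ, y ∈ Icc a b → ‖f (x + y * I)‖ ≤ M / (1 + x ^ 2)) :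
    ∫ x : ℝ, f (x + a * I) = ∫ x : ℝ, f (x + b * I) := by
  have ha : a ∈ Icc a b := ⟨le_rfl, hab⟩
  have hb : b ∈ Icc a b := ⟨hab, le_rfl⟩
  have hlim : ∀ y ∈ Icc a b, Tendsto (fun T : ℝ => ∫ x in (-T)..T, f (x + y * I)) atTop
      (𝓝 (∫ x : ℝ, f (x + y * I))) := fun y hy =>
    intervalIntegral_tendsto_integral
      (integrable_of_norm_le_div_one_add_sq (continuous_on_line fun x => hf x y hy)
        fun x => hM x y hy) tendsto_neg_atTop_atBot tendsto_id
  have hside : ∀ σ : ℝ, σ ^ 2 = 1 → Tendsto (fun T : ℝ => I • ∫ y in a..b,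
      f (((σ * T : ℝ) : ℂ) + y * I)) atTop (𝓝 0) := by
    intro σ hσ
    have h0 : Tendsto (fun T : ℝ => M / (1 + T ^ 2) * |b - a|) atTop (𝓝 0) := by
      simpa using (tendsto_div_one_add_sq M).mul_const |b - a|
    refine squeeze_zero_norm (fun T => ?_) h0
    rw [norm_smul, norm_I, one_mul]
    refine intervalIntegral.norm_integral_le_of_norm_le_const fun y hy => ?_
    rw [uIoc_of_le hab] at hy
    have := hM (σ * T) y ⟨hy.1.le, hy.2⟩
    rwa [mul_pow, hσ, one_mul] at this
  have hrect : ∀ T : ℝ, 0 ≤ T → ((∫ x in (-T)..T, f (x + a * I)) - ∫ x in (-T)..T, f (x + b * I))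
      + (I • ∫ y in a..b, f (((1 * T : ℝ) : ℂ) + y * I))
      - (I • ∫ y in a..b, f (((-1 * T : ℝ) : ℂ) + y * I)) = 0 := by
    intro T hT
    have := integral_boundary_rect_eq_zero_of_differentiableOn f (-T + a * I) (T + b * I) ?_
    · simpa using this
    · intro z hz
      have him : z.im ∈ Icc a b := by
        have := (mem_reProdIm.1 hz).2
        simpa [uIcc_of_le hab] using this
      have := hf z.re z.im him
      rw [re_add_im] at this
      exact this.differentiableWithinAt
  have h := (((hlim a ha).sub (hlim b hb)).add (hside 1 (by norm_num))).sub
    (hside (-1) (by norm_num))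
  have h' := tendsto_nhds_unique (h.congr' ?_) (tendsto_const_nhds (x := (0 : ℂ)))
  · simpa [sub_eq_zero] using h'
  · filter_upwards [eventually_ge_atTop 0] with T hT using hrect T hT

/-- A function that is holomorphic on the strip `|Im z| ≤ b` has a Fourier transform of size
`exp (-2πb|ξ|)`: shift the line of integration to `Im z = -b` or `Im z = b`, by the sign of `ξ`. -/
theorem norm_fourier_le_of_strip {f : ℂ → ℂ} {b M : ℝ} (hb : 0 ≤ b)
    (hf : ∀ x y : ℝ, |y| ≤ b → DifferentiableAt ℂ f (x + y * I))
    (hM : ∀ x y : ℝ, |y| ≤ b → ‖f (x + y * I)‖ ≤ M / (1 + x ^ 2)) (ξ : ℝ) :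
    ‖FourierTransform.fourier (fun x : ℝ => f x) ξ‖
      ≤ Real.pi * M * Real.exp (-2 * Real.pi * b * |ξ|) := by
  have key : ∀ s : ℝ, |s| = b → s * ξ = -(b * |ξ|) →
      ‖FourierTransform.fourier (fun x : ℝ => f x) ξ‖
      ≤ Real.pi * M * Real.exp (-2 * Real.pi * b * |ξ|) := by
    intro s hs hsξ
    set G : ℂ → ℂ := fun z => cexp (-2 * Real.pi * I * ξ * z) * f z with hG
    have hGd : ∀ x y : ℝ, |y| ≤ b → DifferentiableAt ℂ G (x + y * I) := fun x y hy => by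
      have := hf x y hy
      simp only [hG]
      fun_prop
    have hnorm : ∀ x y : ℝ, ‖G (x + y * I)‖ = Real.exp (2 * Real.pi * (y * ξ)) * ‖f (x + y * I)‖ := by
      intro x y
      simp only [hG, norm_mul, norm_exp]
      congr 2
      simp
      ring
    have hGM : ∀ x y : ℝ, |y| ≤ b →
        ‖G (x + y * I)‖ ≤ (Real.exp (2 * Real.pi * (b * |ξ|)) * M) / (1 + x ^ 2) := by
      intro x y hy
      rw [hnorm, mul_div_assoc]
      have h1 : y * ξ ≤ b * |ξ| := by
        calc y * ξ ≤ |y| * |ξ| := by rw [← abs_mul]; exact le_abs_self _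
          _ ≤ b * |ξ| := by gcongr
      have h2 := hM x y hy
      have h3 : Real.exp (2 * Real.pi * (y * ξ)) ≤ Real.exp (2 * Real.pi * (b * |ξ|)) := by gcongr
      exact mul_le_mul h3 h2 (norm_nonneg _) (Real.exp_pos _).le
    have hshift : ∫ x : ℝ, G (x + (0 : ℝ) * I) = ∫ x : ℝ, G (x + s * I) := by
      rcases le_total 0 s with h | h
      · refine integral_line_eq_of_strip h (fun x y hy => hGd x y ?_) (fun x y hy => hGM x y ?_) <;>
        · rw [abs_of_nonneg hy.1]; rw [abs_of_nonneg h] at hs; exact hs ▸ hy.2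
      · refine (integral_line_eq_of_strip h (fun x y hy => hGd x y ?_)
          (fun x y hy => hGM x y ?_)).symm <;>
        · rw [abs_of_nonpos hy.2]; rw [abs_of_nonpos h] at hs; linarith [hy.1]
    have hF : FourierTransform.fourier (fun x : ℝ => f x) ξ = ∫ x : ℝ, G (x + s * I) := by
      rw [← hshift, Real.fourier_eq']
      refine integral_congr_ae (Eventually.of_forall fun x => ?_)
      simp only [hG, smul_eq_mul]
      congr 2
      · simp
        ring
      · simp
    rw [hF]
    refine (norm_integral_le_of_norm_le_div_one_add_sq
      (M := Real.exp (-2 * Real.pi * b * |ξ|) * M) fun x => ?_).trans (le_of_eq (by ring))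
    rw [hnorm, hsξ, mul_div_assoc]
    rw [show 2 * Real.pi * -(b * |ξ|) = -2 * Real.pi * b * |ξ| by ring]
    gcongr
    exact hM x s hs.le
  rcases le_total 0 ξ with h | h
  · refine key (-b) (by rw [abs_neg, abs_of_nonneg hb]) ?_
    rw [abs_of_nonneg h]
    ring
  · refine key b (abs_of_nonneg hb) ?_
    rw [abs_of_nonpos h]
    ring

/-! ### The trapezoidal rule on the real line -/

theorem tsum_int_sub_zero_bound {a : ℤ → ℂ} {B ρ : ℝ} (hρ0 : 0 ≤ ρ) (hρ1 : ρ < 1)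
    (ha : ∀ k : ℤ, ‖a k‖ ≤ B * ρ ^ k.natAbs) :
    Summable a ∧ ‖∑' k, a k - a 0‖ ≤ 2 * B * (ρ / (1 - ρ)) := by
  have hgeo := (hasSum_geometric_of_lt_one hρ0 hρ1).mul_left (B * ρ)
  have hp : ∀ n : ℕ, ‖a (n + 1 : ℕ)‖ ≤ B * ρ * ρ ^ n := fun n =>
    (ha _).trans (le_of_eq (by rw [Int.natAbs_natCast]; ring))
  have hn : ∀ n : ℕ, ‖a (-(n + 1 : ℤ))‖ ≤ B * ρ * ρ ^ n := fun n =>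
    (ha _).trans (le_of_eq (by
      rw [Int.natAbs_neg, show ((n : ℤ) + 1).natAbs = n + 1 by omega]; ring))
  have hps : Summable fun n : ℕ => a (n + 1 : ℕ) := .of_norm_bounded hgeo.summable hp
  have hns : Summable fun n : ℕ => a (-(n + 1 : ℤ)) := .of_norm_bounded hgeo.summable hn
  have hps' : Summable fun n : ℕ => a n := (summable_nat_add_iff 1).1 hps
  refine ⟨.of_nat_of_neg_add_one hps' hns, ?_⟩
  rw [tsum_of_nat_of_neg_add_one hps' hns, hps'.tsum_eq_zero_add]
  have h1 := tsum_of_norm_bounded hgeo hp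
  have h2 := tsum_of_norm_bounded hgeo hn
  have : (a ((0 : ℕ) : ℤ) + ∑' n : ℕ, a (n + 1 : ℕ)) + (∑' n : ℕ, a (-(n + 1 : ℤ))) - a 0
      = ∑' n : ℕ, a (n + 1 : ℕ) + ∑' n : ℕ, a (-(n + 1 : ℤ)) := by
    rw [Nat.cast_zero]
    ring
  rw [this]
  refine (norm_add_le _ _).trans ((add_le_add h1 h2).trans (le_of_eq ?_))
  field_simp
  ring

/-- Error of the trapezoidal rule on the whole line for a function that is holomorphic on the strip
`|Im z| ≤ b`: by Poisson summation it is the sum of the Fourier transform over the nonzero points of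
the dual lattice. -/
theorem norm_trapezoidal_sub_integral_le {f : ℂ → ℂ} {b M h : ℝ} (hb : 0 < b) (hh : 0 < h)
    (hf : ∀ x y : ℝ, |y| ≤ b → DifferentiableAt ℂ f (x + y * I))
    (hM : ∀ x y : ℝ, |y| ≤ b → ‖f (x + y * I)‖ ≤ M / (1 + x ^ 2)) :
    ‖(h : ℂ) * ∑' n : ℤ, f ((n * h : ℝ) : ℂ) - ∫ x : ℝ, f x‖
      ≤ 2 * (Real.pi * M) * (Real.exp (-(2 * Real.pi * b / h))
        / (1 - Real.exp (-(2 * Real.pi * b / h)))) := by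
  have hM0 : 0 ≤ M := by simpa using (norm_nonneg _).trans (hM 0 0 (by simpa using hb.le))
  have hM' : ∀ x : ℝ, ‖f x‖ ≤ M / (1 + x ^ 2) := fun x => by simpa using hM x 0 (by simpa using hb.le)
  have hc : Continuous fun x : ℝ => f x := by
    simpa using continuous_on_line (y := 0) fun x => hf x 0 (by simpa using hb.le)
  set F : ℝ → ℂ := fun x => f ((x * h : ℝ) : ℂ) with hF
  have hFc : Continuous F := hc.comp (continuous_mul_const h)
  have hFO : F =O[cocompact ℝ] fun x : ℝ => |x| ^ (-2 : ℝ) := by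
    refine Asymptotics.IsBigO.of_bound (M / h ^ 2) ?_
    have : ∀ᶠ x : ℝ in cocompact ℝ, x ≠ 0 := by
      simpa using (isCompact_singleton (x := (0 : ℝ))).compl_mem_cocompact
    filter_upwards [this] with x hx
    refine (hM' _).trans ?_
    rw [Real.norm_of_nonneg (by positivity), Real.rpow_neg (abs_nonneg _), ← div_eq_mul_inv,
      div_div]
    have : |x| ^ (2 : ℝ) = x ^ 2 := by
      rw [show (2 : ℝ) = ((2 : ℕ) : ℝ) by norm_num, Real.rpow_natCast, sq_abs]
    rw [this]
    have hx2 : 0 < x ^ 2 := by positivity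
    gcongr
    nlinarith
  have hFF : ∀ ξ : ℝ, FourierTransform.fourier F ξ
      = (h : ℂ)⁻¹ * FourierTransform.fourier (fun x : ℝ => f x) (ξ / h) := by
    intro ξ
    rw [Real.fourier_eq', Real.fourier_eq']
    have := Measure.integral_comp_mul_right
      (fun v : ℝ => cexp (((-2 * Real.pi * inner ℝ v (ξ / h) : ℝ) : ℂ) * I) • f v) h
    rw [abs_of_pos (inv_pos.2 hh)] at this
    rw [← ofReal_inv, ← real_smul, ← this]
    refine integral_congr_ae (Eventually.of_forall fun x => ?_)
    simp only [hF]
    congr 4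
    simp
    field_simp
  have hexp : ∀ k : ℤ, Real.exp (-2 * Real.pi * b * |(k : ℝ) / h|)
      = Real.exp (-(2 * Real.pi * b / h)) ^ k.natAbs := by
    intro k
    rw [← Real.exp_nat_mul, abs_div, abs_of_pos hh, Nat.cast_natAbs, Int.cast_abs]
    congr 1
    field_simp
  have hbd : ∀ k : ℤ, ‖FourierTransform.fourier F (k : ℝ)‖
      ≤ h⁻¹ * (Real.pi * M) * Real.exp (-(2 * Real.pi * b / h)) ^ k.natAbs := by
    intro k
    rw [hFF, norm_mul, norm_inv, norm_real, Real.norm_of_nonneg hh.le, mul_assoc, ← hexp]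
    gcongr
    exact norm_fourier_le_of_strip hb.le hf hM _
  have hρ1 : Real.exp (-(2 * Real.pi * b / h)) < 1 := by
    rw [Real.exp_lt_one_iff, neg_lt_zero]
    positivity
  obtain ⟨hs, hle⟩ := tsum_int_sub_zero_bound (Real.exp_pos _).le hρ1 hbd
  have hP := Real.tsum_eq_tsum_fourier_of_rpow_decay_of_summable hFc one_lt_two hFO hs 0
  simp only [zero_add, QuotientAddGroup.mk_zero, fourier_eval_zero, mul_one] at hP
  have h0 : FourierTransform.fourier F ((0 : ℤ) : ℝ) = (h : ℂ)⁻¹ * ∫ x : ℝ, f x := by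
    rw [hFF, Real.fourier_eq']
    simp
  have hh' : (h : ℂ) ≠ 0 := by exact_mod_cast hh.ne'
  have : (h : ℂ) * ∑' n : ℤ, f ((n * h : ℝ) : ℂ) - ∫ x : ℝ, f x
      = h * (∑' k : ℤ, FourierTransform.fourier F (k : ℝ)
        - FourierTransform.fourier F ((0 : ℤ) : ℝ)) := by
    rw [← hP, h0, mul_sub, mul_inv_cancel_left₀ hh']
  rw [this, norm_mul, norm_real, Real.norm_of_nonneg hh.le]
  refine (mul_le_mul_of_nonneg_left hle hh.le).trans (le_of_eq ?_)
  field_simp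

/-! ### The complementary error function of a complex variable and the smooth window -/

/-- The entire function `erfc z / 2`, as an integral along the horizontal ray from `z` to `+∞`. -/
noncomputable def gaussTail (z : ℂ) : ℂ :=
  ((Real.sqrt Real.pi)⁻¹ : ℝ) * ∫ s in Ioi (0 : ℝ), cexp (-(z + s) ^ 2)

theorem integrable_cexp_neg_add_sq (z : ℂ) : Integrable fun s : ℝ => cexp (-(z + s) ^ 2) := by
  have := integrable_cexp_quadratic' (b := -1) (by simp) (-2 * z) (-z ^ 2)
  refine this.congr (Eventually.of_forall fun s => ?_)
  simp only
  congr 1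
  ring

theorem integral_cexp_neg_add_sq (z : ℂ) :
    ∫ s : ℝ, cexp (-(z + s) ^ 2) = (Real.sqrt Real.pi : ℝ) := by
  have := integral_cexp_quadratic (b := -1) (by simp) (-2 * z) (-z ^ 2)
  have h0 : -z ^ 2 - (-2 * z) ^ 2 / (4 * -1) = 0 := by ring
  rw [h0, Complex.exp_zero, mul_one, neg_neg, div_one] at this
  rw [Real.sqrt_eq_rpow, ofReal_cpow Real.pi_pos.le]
  convert this using 1
  · refine integral_congr_ae (Eventually.of_forall fun s => ?_)
    simp only
    congr 1
    ring
  · norm_num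

theorem gaussTail_add_gaussTail_neg (z : ℂ) : gaussTail z + gaussTail (-z) = 1 := by
  have h1 : ∫ s in Ioi (0 : ℝ), cexp (-(-z + s) ^ 2) = ∫ s in Iic (0 : ℝ), cexp (-(z + s) ^ 2) := by
    have := integral_comp_neg_Ioi (0 : ℝ) fun s : ℝ => cexp (-(z + s) ^ 2)
    rw [neg_zero] at this
    rw [← this]
    refine integral_congr_ae (Eventually.of_forall fun s => ?_)
    simp only
    congr 1
    push_cast
    ring
  have hi := integrable_cexp_neg_add_sq z
  have h2 := intervalIntegral.integral_Iic_add_Ioi (b := (0 : ℝ)) hi.integrableOn hi.integrableOn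
  rw [integral_cexp_neg_add_sq] at h2
  rw [gaussTail, gaussTail, h1, ← mul_add, add_comm, h2, ← ofReal_mul,
    inv_mul_cancel₀ (Real.sqrt_pos.2 Real.pi_pos).ne', ofReal_one]

/-- In the right half-plane `erfc z` is controlled by the Gaussian `exp (-z ^ 2)`. -/
theorem norm_gaussTail_le {z : ℂ} (hz : 0 ≤ z.re) :
    ‖gaussTail z‖ ≤ Real.exp (z.im ^ 2 - z.re ^ 2) := by
  have h1 : ‖∫ s in Ioi (0 : ℝ), cexp (-(z + s) ^ 2)‖
      ≤ Real.exp (z.im ^ 2 - z.re ^ 2) * (Real.sqrt (Real.pi / 1) / 2) := by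
    rw [← integral_gaussian_Ioi, ← integral_const_mul]
    refine norm_integral_le_of_norm_le
      (((integrable_exp_neg_mul_sq one_pos).integrableOn).const_mul _) ?_
    filter_upwards [ae_restrict_mem measurableSet_Ioi] with s hs
    rw [norm_exp, ← Real.exp_add]
    refine Real.exp_le_exp.2 ?_
    have : 0 ≤ z.re * s := mul_nonneg hz (le_of_lt hs)
    simp [sq]
    nlinarith
  rw [gaussTail, norm_mul, norm_real, norm_inv, Real.norm_of_nonneg (Real.sqrt_nonneg _)]
  have hpi := Real.sqrt_pos.2 Real.pi_pos
  rw [inv_mul_le_iff₀ hpi]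
  refine h1.trans ?_
  rw [div_one, mul_comm]
  gcongr
  linarith

theorem gaussTail_eq_one_sub (z : ℂ) : gaussTail z = 1 - gaussTail (-z) :=
  eq_sub_of_add_eq (gaussTail_add_gaussTail_neg z)

theorem differentiable_gaussTail : Differentiable ℂ gaussTail := by
  intro z₀
  set R : ℝ := ‖z₀‖ + 1 with hR
  have hR0 : 0 < R := by positivity
  have key := (hasDerivAt_integral_of_dominated_loc_of_deriv_le
    (μ := volume.restrict (Ioi (0 : ℝ))) (F := fun (z : ℂ) (s : ℝ) => cexp (-(z + s) ^ 2))
    (F' := fun (z : ℂ) (s : ℝ) => cexp (-(z + s) ^ 2) * -(2 * (z + s)))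
    (x₀ := z₀) (s := Metric.ball z₀ 1)
    (bound := fun s : ℝ => (2 * (R + 1) * Real.exp (R ^ 2)) * Real.exp (-(1 / 4) * s ^ 2))
    (Metric.ball_mem_nhds _ one_pos)
    (Eventually.of_forall fun z => (integrable_cexp_neg_add_sq z).aestronglyMeasurable.restrict)
    (integrable_cexp_neg_add_sq z₀).integrableOn
    (Continuous.aestronglyMeasurable (by fun_prop)) ?_
    (((integrable_exp_neg_mul_sq (by norm_num)).const_mul _).integrableOn) ?_).2
  · exact key.differentiableAt.const_mul _
  · refine Eventually.of_forall fun s z hz => ?_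
    have hzR : ‖z‖ ≤ R := by
      have : ‖z - z₀‖ < 1 := by rwa [← dist_eq_norm]
      have h2 := norm_add_le (z - z₀) z₀
      rw [sub_add_cancel] at h2
      linarith
    have hz2 : z.re ^ 2 + z.im ^ 2 ≤ R ^ 2 := by
      have : z.re ^ 2 + z.im ^ 2 = ‖z‖ ^ 2 := by rw [← normSq_eq_norm_sq, normSq_apply]; ring
      rw [this]
      gcongr
    have h1 : ‖cexp (-(z + s) ^ 2)‖ ≤ Real.exp (R ^ 2) * Real.exp (-(1 / 2) * s ^ 2) := by
      rw [norm_exp, ← Real.exp_add]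
      refine Real.exp_le_exp.2 ?_
      simp [sq]
      nlinarith [sq_nonneg (2 * z.re + s)]
    have h3 : |s| ≤ Real.exp (1 / 4 * s ^ 2) := by
      have := Real.add_one_le_exp (1 / 4 * s ^ 2)
      nlinarith [sq_nonneg (|s| - 2), sq_abs s]
    have h4 : 1 ≤ Real.exp (1 / 4 * s ^ 2) := Real.one_le_exp (by positivity)
    have h2 : ‖-(2 * (z + s))‖ ≤ 2 * (R + 1) * Real.exp (1 / 4 * s ^ 2) := by
      rw [norm_neg, norm_mul]
      have h5 : ‖z + s‖ ≤ R + |s| := (norm_add_le _ _).trans (by simpa using hzR)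
      have : ‖(2 : ℂ)‖ = 2 := by simp
      rw [this]
      nlinarith
    rw [norm_mul]
    refine (mul_le_mul h1 h2 (norm_nonneg _) (by positivity)).trans (le_of_eq ?_)
    rw [show -(1 / 4) * s ^ 2 = -(1 / 2) * s ^ 2 + 1 / 4 * s ^ 2 by ring, Real.exp_add]
    ring
  · refine Eventually.of_forall fun s z hz => ?_
    have h := (((hasDerivAt_id z).add_const (s : ℂ)).pow 2).neg.cexp
    simpa using h

theorem window_eq_gaussTail (y p q : ℝ) : ((window y p q : ℝ) : ℂ) = gaussTail ((y / p - q : ℝ) : ℂ) := by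
  have h : ∫ s in Ioi (0 : ℝ), cexp (-(((y / p - q : ℝ) : ℂ) + s) ^ 2)
      = ((∫ s in Ioi (y / p - q), Real.exp (-s ^ 2) : ℝ) : ℂ) := by
    have := (measurePreserving_add_left volume (y / p - q)).setIntegral_preimage_emb
      (measurableEmbedding_addLeft _) (fun s => Real.exp (-s ^ 2)) (Ioi (y / p - q))
    rw [preimage_const_add_Ioi, sub_self] at this
    rw [← this, ← integral_complex_ofReal]
    refine integral_congr_ae (Eventually.of_forall fun s => ?_)
    simp only
    push_cast
    rfl
  rw [gaussTail, h, window, erfc]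
  push_cast
  ring

/-- An entire substitute for the window `x ↦ w(|x|; p, q)`: it is
`erfc (t / p - q) / 2 - erfc (t / p + q) / 2`, an even function. -/
noncomputable def smoothWindow (p q : ℝ) (t : ℂ) : ℂ := gaussTail (t / p - q) - gaussTail (t / p + q)

theorem differentiable_smoothWindow (p q : ℝ) : Differentiable ℂ (smoothWindow p q) := by
  unfold smoothWindow
  exact (differentiable_gaussTail.comp (by fun_prop)).sub
    (differentiable_gaussTail.comp (by fun_prop))

theorem smoothWindow_neg (p q : ℝ) (t : ℂ) : smoothWindow p q (-t) = smoothWindow p q t := by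
  unfold smoothWindow
  rw [gaussTail_eq_one_sub (-t / p - q), gaussTail_eq_one_sub (-t / p + q)]
  rw [show -(-t / p - q : ℂ) = t / p + q by ring, show -(-t / p + q : ℂ) = t / p - q by ring]
  ring

theorem one_sub_smoothWindow (p q : ℝ) (t : ℂ) :
    1 - smoothWindow p q t = gaussTail (q - t / p) + gaussTail (t / p + q) := by
  unfold smoothWindow
  rw [gaussTail_eq_one_sub (t / p - q), show -(t / p - q : ℂ) = q - t / p by ring]
  ring

theorem norm_gaussTail_add_le {p q : ℝ} (hp : 0 < p) (hq : 0 ≤ q) {t : ℂ} (ht : 0 ≤ t.re) :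
    ‖gaussTail (t / p + q)‖ ≤ Real.exp ((t.im / p) ^ 2 - (t.re / p + q) ^ 2) := by
  simpa using norm_gaussTail_le (z := t / p + q) (by simp; positivity)

theorem norm_smoothWindow_le_of_re_le {p q : ℝ} (hp : 0 < p) (hq : 0 ≤ q) {t : ℂ}
    (ht : |t.re| ≤ p * q) : ‖1 - smoothWindow p q t‖
      ≤ 2 * Real.exp ((t.im / p) ^ 2 - (|t.re| / p - q) ^ 2) := by
  wlog h : 0 ≤ t.re generalizing t
  · have := this (t := -t) (by simpa using ht) (by simp; linarith)
    simpa [smoothWindow_neg, neg_div] using this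
  rw [abs_of_nonneg h] at ht ⊢
  rw [one_sub_smoothWindow]
  have h1 := norm_gaussTail_add_le hp hq h
  have h2 := norm_gaussTail_le (z := q - t / p) (by
    simp
    rw [div_le_iff₀ hp]; linarith)
  have h3 : Real.exp ((t.im / p) ^ 2 - (t.re / p + q) ^ 2)
      ≤ Real.exp ((t.im / p) ^ 2 - (t.re / p - q) ^ 2) := by
    have : 0 ≤ t.re / p * q := by positivity
    refine Real.exp_le_exp.2 ?_
    nlinarith
  have h4 : Real.exp ((q - t / p : ℂ).im ^ 2 - (q - t / p : ℂ).re ^ 2)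
      = Real.exp ((t.im / p) ^ 2 - (t.re / p - q) ^ 2) := by
    congr 1
    simp
    ring
  rw [h4] at h2
  linarith [norm_add_le (gaussTail (q - t / p)) (gaussTail (t / p + q))]

theorem norm_smoothWindow_le_of_le_re {p q : ℝ} (hp : 0 < p) (hq : 0 ≤ q) {t : ℂ}
    (ht : p * q ≤ |t.re|) : ‖smoothWindow p q t‖
      ≤ 2 * Real.exp ((t.im / p) ^ 2 - (|t.re| / p - q) ^ 2) := by
  wlog h : 0 ≤ t.re generalizing t
  · have := this (t := -t) (by simpa using ht) (by simp; linarith)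
    simpa [smoothWindow_neg, neg_div] using this
  rw [abs_of_nonneg h] at ht ⊢
  have h1 := norm_gaussTail_add_le hp hq h
  have h2 := norm_gaussTail_le (z := t / p - q) (by
    simp
    rw [le_div_iff₀ hp]; linarith)
  have h3 : Real.exp ((t.im / p) ^ 2 - (t.re / p + q) ^ 2)
      ≤ Real.exp ((t.im / p) ^ 2 - (t.re / p - q) ^ 2) := by
    have : 0 ≤ t.re / p * q := by positivity
    refine Real.exp_le_exp.2 ?_
    nlinarith
  have h4 : Real.exp ((t / p - q : ℂ).im ^ 2 - (t / p - q : ℂ).re ^ 2)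
      = Real.exp ((t.im / p) ^ 2 - (t.re / p - q) ^ 2) := by
    congr 1
    simp
  rw [h4] at h2
  unfold smoothWindow
  linarith [norm_sub_le (gaussTail (t / p - q)) (gaussTail (t / p + q))]

/-! ### The amplitude as a Gaussian integral, and polar coordinates -/

/-- The analytic continuation of `amplitude` to complex `t`. -/
noncomputable def complexAmplitude {m : ℕ} (θ γ : Fin m → ℝ) (t₀ : ℝ) (t : ℂ) : ℂ :=
  ∏ i, cexp ((γ i : ℂ) ^ 2 / (4 * ((θ i : ℂ) - I * t - t₀))) / ((θ i : ℂ) - I * t - t₀) ^ (1 / 2 : ℂ)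

theorem differentiableAt_complexAmplitude {m : ℕ} {θ γ : Fin m → ℝ} {t₀ : ℝ} {t : ℂ}
    (ht : ∀ i, (θ i : ℂ) - I * t - t₀ ∈ slitPlane) :
    DifferentiableAt ℂ (complexAmplitude θ γ t₀) t := by
  unfold complexAmplitude
  refine DifferentiableAt.fun_finsetProd fun i _ => ?_
  have hne := slitPlane_ne_zero (ht i)
  have hd : DifferentiableAt ℂ (fun t : ℂ => (θ i : ℂ) - I * t - t₀) t := by fun_prop
  refine DifferentiableAt.div ?_ (hd.cpow_const (ht i)) ?_
  · exact (DifferentiableAt.div (by fun_prop) (hd.const_mul 4) (by simpa using hne)).cexp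
  · simp [cpow_eq_zero_iff, hne]

theorem norm_complexAmplitude_le {m : ℕ} {θ γ : Fin m → ℝ} {t₀ r : ℝ} {t : ℂ} (hr : 0 < r)
    (ht : ∀ i, r ≤ ‖(θ i : ℂ) - I * t - t₀‖) :
    ‖complexAmplitude θ γ t₀ t‖ ≤ ∏ i, Real.exp (γ i ^ 2 / (4 * r)) / r ^ (1 / 2 : ℝ) := by
  unfold complexAmplitude
  rw [norm_prod]
  refine Finset.prod_le_prod (fun i _ => norm_nonneg _) fun i _ => ?_
  rw [norm_div]
  have h1 : ‖((θ i : ℂ) - I * t - t₀) ^ (1 / 2 : ℂ)‖ = ‖(θ i : ℂ) - I * t - t₀‖ ^ (1 / 2 : ℝ) := by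
    rw [← norm_cpow_real]
    norm_num
  rw [h1]
  have h2 := ht i
  have h3 : ‖cexp ((γ i : ℂ) ^ 2 / (4 * ((θ i : ℂ) - I * t - t₀)))‖
      ≤ Real.exp (γ i ^ 2 / (4 * r)) := by
    refine (norm_exp_le_exp_norm _).trans (Real.exp_le_exp.2 ?_)
    rw [norm_div, norm_mul, norm_pow, norm_real, Real.norm_eq_abs, sq_abs]
    have : ‖(4 : ℂ)‖ = 4 := by simp
    rw [this]
    gcongr
  gcongr

theorem ofReal_div_cpow {r : ℝ} {b : ℂ} (hr : 0 < r) (hb : 0 < b.re) (s : ℂ) :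
    ((r : ℂ) / b) ^ s = (r : ℂ) ^ s / b ^ s := by
  have hb0 : b ≠ 0 := fun h => by simp [h] at hb
  have hr0 : (r : ℂ) ≠ 0 := by exact_mod_cast hr.ne'
  have harg : b.arg ≠ Real.pi := slitPlane_arg_ne_pi (Or.inl hb)
  rw [div_eq_mul_inv, div_eq_mul_inv, ← inv_cpow _ _ harg, cpow_def_of_ne_zero (by simp [hr0, hb0]),
    cpow_def_of_ne_zero hr0, cpow_def_of_ne_zero (inv_ne_zero hb0), ← Complex.exp_add,
    log_ofReal_mul hr (inv_ne_zero hb0), ofReal_log hr.le, add_mul]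

/-- The exponent of the Gaussian whose spherical means are Fisher--Bingham integrals. -/
noncomputable def gaussExponent {m : ℕ} (θ γ : Fin m → ℝ) (t₀ : ℝ) (x : EuclideanSpace ℝ (Fin m)) :
    ℝ := ∑ i, (-(θ i - t₀) * x i ^ 2 + γ i * x i)

theorem continuous_gaussExponent {m : ℕ} (θ γ : Fin m → ℝ) (t₀ : ℝ) :
    Continuous (gaussExponent θ γ t₀) := by
  unfold gaussExponent
  fun_prop

section
variable {m : ℕ} {θ : Fin m → ℝ} {t₀ : ℝ}

theorem integrable_cexp_gaussExponent (γ : Fin m → ℝ) (hθ : ∀ i, t₀ < θ i) :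
    Integrable fun x : EuclideanSpace ℝ (Fin m) => cexp (gaussExponent θ γ t₀ x) := by
  rw [← (PiLp.volume_preserving_toLp (Fin m)).integrable_comp_emb
    (MeasurableEquiv.toLp 2 _).measurableEmbedding]
  have := GaussianFourier.integrable_cexp_neg_sum_mul_add (b := fun i => ((θ i - t₀ : ℝ) : ℂ))
    (fun i => by rw [ofReal_re]; linarith [hθ i]) (fun i => (γ i : ℂ))
  refine this.congr (Eventually.of_forall fun v => ?_)
  simp only [gaussExponent, Finset.sum_add_distrib, neg_mul, Finset.sum_neg_distrib,
    Function.comp_apply]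
  push_cast
  rfl

/-- The amplitude is the Fourier transform of the law of `‖x‖ ^ 2` under a Gaussian weight. -/
theorem integral_cexp_gaussExponent_mul (γ : Fin m → ℝ) (hθ : ∀ i, t₀ < θ i) (t : ℝ) :
    ∫ x : EuclideanSpace ℝ (Fin m), cexp (gaussExponent θ γ t₀ x) * cexp (I * t * (‖x‖ ^ 2 : ℝ))
      = (Real.pi : ℂ) ^ ((m : ℂ) / 2) * amplitude θ γ t₀ t := by
  rw [← (PiLp.volume_preserving_toLp (Fin m)).integral_comp
    (MeasurableEquiv.toLp 2 _).measurableEmbedding]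
  have hre : ∀ i, 0 < ((θ i : ℂ) - I * t - t₀).re := fun i => by simp; linarith [hθ i]
  have := GaussianFourier.integral_cexp_neg_sum_mul_add (b := fun i => (θ i : ℂ) - I * t - t₀)
    hre (fun i => (γ i : ℂ))
  have hR : (Real.pi : ℂ) ^ ((m : ℂ) / 2) * amplitude θ γ t₀ t
      = ∏ i, ((Real.pi : ℂ) / ((θ i : ℂ) - I * t - t₀)) ^ (1 / 2 : ℂ)
        * cexp ((γ i : ℂ) ^ 2 / (4 * ((θ i : ℂ) - I * t - t₀))) := by
    have hm : (Real.pi : ℂ) ^ ((m : ℂ) / 2) = ∏ _i : Fin m, (Real.pi : ℂ) ^ (1 / 2 : ℂ) := by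
      rw [Finset.prod_const, Finset.card_univ, Fintype.card_fin, ← cpow_nat_mul]
      congr 1
      ring
    rw [hm, amplitude, ← Finset.prod_mul_distrib]
    refine Finset.prod_congr rfl fun i _ => ?_
    rw [ofReal_div_cpow Real.pi_pos (hre i)]
    ring
  rw [hR, ← this]
  refine integral_congr_ae (Eventually.of_forall fun v => ?_)
  simp only
  rw [← Complex.exp_add, EuclideanSpace.norm_sq_eq]
  congr 1
  simp only [gaussExponent]
  push_cast
  rw [Finset.mul_sum, ← Finset.sum_neg_distrib, ← Finset.sum_add_distrib, ← Finset.sum_add_distrib]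
  refine Finset.sum_congr rfl fun i _ => ?_
  have : ((‖v i‖ : ℝ) : ℂ) ^ 2 = (v i : ℂ) ^ 2 := by
    rw [Real.norm_eq_abs, ← ofReal_pow, sq_abs, ofReal_pow]
  simp only [this]
  ring

end

section Polar

open Measure Metric

variable {E : Type*} [NormedAddCommGroup E] [NormedSpace ℝ E] [MeasurableSpace E] [BorelSpace E]
  [FiniteDimensional ℝ E] [Nontrivial E] (μ : Measure E) [μ.IsAddHaarMeasure]

/-- Integration in polar coordinates, for functions that need not be radial. -/
theorem integral_eq_integral_sphere {f : E → ℂ} (hf : Integrable f μ) :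
    IntegrableOn (fun r : ℝ => r ^ (Module.finrank ℝ E - 1)
        • ∫ y : sphere (0 : E) 1, f (r • (y : E)) ∂μ.toSphere) (Ioi 0)
    ∧ ∫ x, f x ∂μ = ∫ r in Ioi (0 : ℝ), r ^ (Module.finrank ℝ E - 1)
        • ∫ y : sphere (0 : E) 1, f (r • (y : E)) ∂μ.toSphere := by
  set n := Module.finrank ℝ E - 1
  set S : ℝ → ℂ := fun r => ∫ y : sphere (0 : E) 1, f (r • (y : E)) ∂μ.toSphere with hS
  set F : sphere (0 : E) 1 × Ioi (0 : ℝ) → ℂ := fun p => f ((p.2 : ℝ) • (p.1 : E)) with hF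
  have hmp := μ.measurePreserving_homeomorphUnitSphereProd
  have hemb := (homeomorphUnitSphereProd E).measurableEmbedding
  have hcomp : F ∘ homeomorphUnitSphereProd E = fun x : ({0}ᶜ : Set E) => f x := by
    funext x
    have hx : ‖(x : E)‖ ≠ 0 := norm_ne_zero_iff.2 x.2
    simp [hF, smul_smul, hx]
  have hFi : Integrable F (μ.toSphere.prod (volumeIoiPow n)) := by
    rw [← hmp.integrable_comp_emb hemb, hcomp]
    have : IntegrableOn f ({0}ᶜ : Set E) μ := hf.integrableOn
    exact (integrableOn_iff_comap_subtypeVal (measurableSet_singleton _).compl).1 this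
  have hmeas : Measurable fun r : Ioi (0 : ℝ) => ENNReal.ofReal (r.1 ^ n) := by fun_prop
  have hi : Integrable (fun r : Ioi (0 : ℝ) => S r) (volumeIoiPow n) := hFi.integral_prod_right
  have hpow : ∀ r : Ioi (0 : ℝ), (ENNReal.ofReal (r.1 ^ n)).toReal = (r : ℝ) ^ n := fun r =>
    ENNReal.toReal_ofReal (pow_nonneg (le_of_lt r.2) _)
  constructor
  · rw [volumeIoiPow, integrable_withDensity_iff_integrable_smul' hmeas
      (Eventually.of_forall fun _ => ENNReal.ofReal_lt_top)] at hi
    simp only [hpow] at hi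
    exact (integrableOn_iff_comap_subtypeVal measurableSet_Ioi).2 hi
  · calc ∫ x, f x ∂μ = ∫ x : ({0}ᶜ : Set E), f x ∂(μ.comap (↑)) := by
          rw [integral_subtype_comap (measurableSet_singleton _).compl f, restrict_compl_singleton]
      _ = ∫ p, F p ∂(μ.toSphere.prod (volumeIoiPow n)) := by
          rw [← hmp.integral_comp hemb]
          exact integral_congr_ae (Eventually.of_forall fun x => (congrFun hcomp x).symm)
      _ = ∫ r, S r ∂(volumeIoiPow n) := integral_prod_symm F hFi
      _ = ∫ r : Ioi (0 : ℝ), (r : ℝ) ^ n • S r ∂(comap Subtype.val volume) := by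
          rw [volumeIoiPow, integral_withDensity_eq_integral_toReal_smul hmeas
            (Eventually.of_forall fun _ => ENNReal.ofReal_lt_top)]
          simp only [hpow]
      _ = _ := integral_subtype_comap measurableSet_Ioi fun r : ℝ => r ^ n • S r

end Polar

/-! ### Fourier inversion at the unit sphere -/

section

variable {m : ℕ} {θ : Fin m → ℝ} {t₀ : ℝ}

/-- The integral of the Gaussian weight over the sphere of radius `r`, without the factor
`r ^ (m - 1)`. -/
noncomputable def sphereMean (θ γ : Fin m → ℝ) (t₀ r : ℝ) : ℂ :=
  ∫ y : Metric.sphere (0 : EuclideanSpace ℝ (Fin m)) 1,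
    cexp (gaussExponent θ γ t₀ (r • (y : EuclideanSpace ℝ (Fin m))))
    ∂(volume : Measure (EuclideanSpace ℝ (Fin m))).toSphere

theorem continuous_sphereMean (θ γ : Fin m → ℝ) (t₀ : ℝ) :
    Continuous (sphereMean θ γ t₀) := by
  have h : Continuous (Function.uncurry
      fun (r : ℝ) (y : Metric.sphere (0 : EuclideanSpace ℝ (Fin m)) 1) =>
        cexp (gaussExponent θ γ t₀ (r • (y : EuclideanSpace ℝ (Fin m))))) := by
    have := continuous_gaussExponent θ γ t₀
    simp only [Function.uncurry_def]
    fun_prop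
  unfold sphereMean
  simpa using continuous_parametric_integral_of_continuous
    (μ := (volume : Measure (EuclideanSpace ℝ (Fin m))).toSphere) h (isCompact_univ)

theorem sphereMean_one (θ γ : Fin m → ℝ) (t₀ : ℝ) :
    sphereMean θ γ t₀ 1 = (Real.exp t₀ * normConst θ γ : ℝ) := by
  rw [sphereMean, normConst, ← integral_const_mul, ← integral_complex_ofReal]
  refine integral_congr_ae (Eventually.of_forall fun y => ?_)
  simp only [one_smul]
  rw [← Real.exp_add, ofReal_exp]
  congr 2
  have hy : ∑ i, (y : EuclideanSpace ℝ (Fin m)) i ^ 2 = 1 := by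
    rw [← EuclideanSpace.real_norm_sq_eq, norm_eq_of_mem_sphere]
    norm_num
  rw [gaussExponent]
  calc _ = ∑ i, (t₀ * (y : EuclideanSpace ℝ (Fin m)) i ^ 2
      + (-θ i * (y : EuclideanSpace ℝ (Fin m)) i ^ 2
        + γ i * (y : EuclideanSpace ℝ (Fin m)) i)) :=
        Finset.sum_congr rfl fun i _ => by ring
    _ = _ := by rw [Finset.sum_add_distrib, ← Finset.mul_sum, hy, mul_one]

/-- The density of `‖x‖ ^ 2` under the Gaussian weight. -/
noncomputable def sqNormDensity (θ γ : Fin m → ℝ) (t₀ u : ℝ) : ℂ :=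
  (Ioi (0 : ℝ)).indicator
    (fun u => ((1 / 2 * u ^ ((m : ℝ) / 2 - 1) : ℝ) : ℂ) * sphereMean θ γ t₀ (Real.sqrt u)) u

theorem sqNormDensity_sq (γ : Fin m → ℝ) (hm : 1 ≤ m) {r : ℝ} (hr : 0 < r) :
    ((2 * r ^ ((2 : ℝ) - 1) : ℝ) : ℂ) * sqNormDensity θ γ t₀ (r ^ (2 : ℝ))
      = ((r ^ (m - 1) : ℝ) : ℂ) * sphereMean θ γ t₀ r := by
  have h1 : r ^ (2 : ℝ) = r ^ 2 := by norm_cast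
  have h2 : (2 * r ^ ((2 : ℝ) - 1)) * (1 / 2 * (r ^ (2 : ℝ)) ^ ((m : ℝ) / 2 - 1)) = r ^ (m - 1) := by
    rw [← Real.rpow_mul hr.le, ← Real.rpow_natCast, Nat.cast_sub hm]
    calc _ = r ^ ((2 : ℝ) - 1) * r ^ ((2 : ℝ) * ((m : ℝ) / 2 - 1)) := by ring
      _ = _ := by
        rw [← Real.rpow_add hr]
        congr 1
        push_cast
        ring
  rw [sqNormDensity, indicator_of_mem (by exact Real.rpow_pos_of_pos hr _), ← mul_assoc,
    ← ofReal_mul, h2, h1, Real.sqrt_sq hr.le]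

theorem sqNormDensity_one (θ γ : Fin m → ℝ) (t₀ : ℝ) :
    sqNormDensity θ γ t₀ 1 = 1 / 2 * (Real.exp t₀ * normConst θ γ : ℝ) := by
  rw [sqNormDensity, indicator_of_mem (by simp), Real.sqrt_one, sphereMean_one]
  simp

theorem continuousAt_sqNormDensity (θ γ : Fin m → ℝ) (t₀ : ℝ) :
    ContinuousAt (sqNormDensity θ γ t₀) 1 := by
  have h : ContinuousAt (fun u : ℝ => ((1 / 2 * u ^ ((m : ℝ) / 2 - 1) : ℝ) : ℂ)
      * sphereMean θ γ t₀ (Real.sqrt u)) 1 := by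
    refine ContinuousAt.mul ?_ ?_
    · refine continuous_ofReal.continuousAt.comp ?_
      exact continuousAt_const.mul (Real.continuousAt_rpow_const _ _ (Or.inl one_ne_zero))
    · exact ((continuous_sphereMean θ γ t₀).comp Real.continuous_sqrt).continuousAt
  refine h.congr ?_
  filter_upwards [Ioi_mem_nhds (zero_lt_one (α := ℝ))] with u hu
  rw [sqNormDensity, indicator_of_mem hu]

/-- Integrals of functions of `‖x‖ ^ 2` against the Gaussian weight, by polar coordinates and the
substitution `u = r ^ 2`. -/
theorem integral_sqNormDensity_mul (γ : Fin m → ℝ) (hm : 1 ≤ m) {k : ℝ → ℂ}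
    (hk : Integrable fun x : EuclideanSpace ℝ (Fin m) =>
      cexp (gaussExponent θ γ t₀ x) * k (‖x‖ ^ 2)) :
    Integrable (fun u => sqNormDensity θ γ t₀ u * k u) ∧
    ∫ x : EuclideanSpace ℝ (Fin m), cexp (gaussExponent θ γ t₀ x) * k (‖x‖ ^ 2)
      = ∫ u, sqNormDensity θ γ t₀ u * k u := by
  have : Nonempty (Fin m) := ⟨⟨0, hm⟩⟩
  obtain ⟨hint, heq⟩ := integral_eq_integral_sphere _ hk
  have hinner : ∀ r : ℝ, 0 < r → r ^ (Module.finrank ℝ (EuclideanSpace ℝ (Fin m)) - 1) •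
      (∫ y : Metric.sphere (0 : EuclideanSpace ℝ (Fin m)) 1,
        cexp (gaussExponent θ γ t₀ (r • (y : EuclideanSpace ℝ (Fin m))))
          * k (‖r • (y : EuclideanSpace ℝ (Fin m))‖ ^ 2)
        ∂(volume : Measure (EuclideanSpace ℝ (Fin m))).toSphere)
      = (2 * r ^ ((2 : ℝ) - 1)) •
        (sqNormDensity θ γ t₀ (r ^ (2 : ℝ)) * k (r ^ (2 : ℝ))) := by
    intro r hr
    have hy : ∀ y : Metric.sphere (0 : EuclideanSpace ℝ (Fin m)) 1,
        ‖r • (y : EuclideanSpace ℝ (Fin m))‖ ^ 2 = r ^ (2 : ℝ) := fun y => by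
      rw [norm_smul, norm_eq_of_mem_sphere, mul_one, Real.norm_of_nonneg hr.le]
      norm_cast
    simp only [hy]
    rw [integral_mul_const, real_smul, real_smul, ← mul_assoc, ← mul_assoc,
      sqNormDensity_sq γ hm hr, finrank_euclideanSpace_fin]
    rfl
  have hzero : (fun u => sqNormDensity θ γ t₀ u * k u)
      = (Ioi (0 : ℝ)).indicator fun u => sqNormDensity θ γ t₀ u * k u := by
    funext u
    by_cases hu : u ∈ Ioi (0 : ℝ)
    · rw [indicator_of_mem hu]
    · rw [indicator_of_notMem hu, sqNormDensity, indicator_of_notMem hu, zero_mul]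
  constructor
  · rw [hzero, integrable_indicator_iff measurableSet_Ioi,
      ← integrableOn_Ioi_comp_rpow_iff _ two_ne_zero]
    refine hint.congr_fun (fun r hr => ?_) measurableSet_Ioi
    rw [abs_two]
    exact hinner r hr
  · rw [heq, hzero, integral_indicator measurableSet_Ioi,
      ← integral_comp_rpow_Ioi_of_pos (g := fun u => sqNormDensity θ γ t₀ u * k u) two_pos]
    exact setIntegral_congr_fun measurableSet_Ioi fun r hr => hinner r hr

theorem integrable_sqNormDensity (γ : Fin m → ℝ) (hm : 1 ≤ m) (hθ : ∀ i, t₀ < θ i) :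
    Integrable (sqNormDensity θ γ t₀) := by
  simpa using (integral_sqNormDensity_mul (k := fun _ => 1) γ hm
    (by simpa using integrable_cexp_gaussExponent γ hθ)).1

theorem integral_gaussian_mul_amplitude (γ : Fin m → ℝ) (hm : 1 ≤ m) (hθ : ∀ i, t₀ < θ i) {ε : ℝ}
    (hε : 0 < ε) :
    (Real.pi : ℂ) ^ ((m : ℂ) / 2)
      * ∫ t : ℝ, cexp (-ε * t ^ 2) * (amplitude θ γ t₀ t * cexp (-I * t))
    = ∫ u : ℝ, sqNormDensity θ γ t₀ u
      * ((Real.pi / ε : ℂ) ^ (1 / 2 : ℂ) * cexp (-(u - 1) ^ 2 / (4 * ε))) := by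
  set Φ : EuclideanSpace ℝ (Fin m) → ℂ := fun x => cexp (gaussExponent θ γ t₀ x) with hΦ
  have hΦi : Integrable Φ := integrable_cexp_gaussExponent γ hθ
  have hΦc : Continuous Φ := by
    have := continuous_gaussExponent θ γ t₀
    simp only [hΦ]
    fun_prop
  have hεre : 0 < (ε : ℂ).re := by simpa using hε
  have hgi : Integrable fun t : ℝ => cexp (-ε * t ^ 2) := integrable_cexp_neg_mul_sq hεre
  have hprod : Integrable (Function.uncurry fun (t : ℝ) (x : EuclideanSpace ℝ (Fin m)) =>
      cexp (-ε * t ^ 2) * Φ x * cexp (I * t * ((‖x‖ ^ 2 : ℝ) - 1 : ℂ)))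
      (volume.prod volume) := by
    refine (hgi.mul_prod hΦi).mono (Continuous.aestronglyMeasurable ?_)
      (Eventually.of_forall fun p => ?_)
    · simp only [Function.uncurry_def]
      fun_prop
    · simp only [Function.uncurry_def]
      rw [norm_mul (_ * _)]
      have : ‖cexp (I * p.1 * ((‖p.2‖ ^ 2 : ℝ) - 1 : ℂ))‖ = 1 := by
        rw [show I * p.1 * ((‖p.2‖ ^ 2 : ℝ) - 1 : ℂ) = ((p.1 * (‖p.2‖ ^ 2 - 1) : ℝ) : ℂ) * I by
          push_cast; ring]
        exact norm_exp_ofReal_mul_I _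
      rw [this, mul_one]
  have hinner : ∀ x : EuclideanSpace ℝ (Fin m), ∫ t : ℝ,
      cexp (-ε * t ^ 2) * Φ x * cexp (I * t * ((‖x‖ ^ 2 : ℝ) - 1 : ℂ))
      = Φ x * ((Real.pi / ε : ℂ) ^ (1 / 2 : ℂ)
        * cexp (-(((‖x‖ ^ 2 : ℝ) : ℂ) - 1) ^ 2 / (4 * ε))) := by
    intro x
    rw [← fourierIntegral_gaussian hεre, ← integral_const_mul]
    refine integral_congr_ae (Eventually.of_forall fun t => ?_)
    simp only
    rw [show I * (((‖x‖ ^ 2 : ℝ) : ℂ) - 1) * t = I * t * (((‖x‖ ^ 2 : ℝ) : ℂ) - 1) by ring]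
    ring
  have hi2 := hprod.integral_prod_right
  simp only [Function.uncurry_def, hinner] at hi2
  have hdens := (integral_sqNormDensity_mul γ hm (k := fun u => (Real.pi / ε : ℂ) ^ (1 / 2 : ℂ)
        * cexp (-((u : ℂ) - 1) ^ 2 / (4 * ε))) hi2).2
  rw [← hdens, ← integral_const_mul]
  calc _ = ∫ t : ℝ, ∫ x, cexp (-ε * t ^ 2) * Φ x * cexp (I * t * ((‖x‖ ^ 2 : ℝ) - 1 : ℂ)) := by
        refine integral_congr_ae (Eventually.of_forall fun t => ?_)
        simp only
        have := integral_cexp_gaussExponent_mul γ hθ t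
        calc _ = cexp (-ε * t ^ 2) * cexp (-I * t)
              * ((Real.pi : ℂ) ^ ((m : ℂ) / 2) * amplitude θ γ t₀ t) := by ring
          _ = _ := by
            rw [← this, ← integral_const_mul]
            refine integral_congr_ae (Eventually.of_forall fun x => ?_)
            simp only
            rw [show I * t * ((‖x‖ ^ 2 : ℝ) - 1 : ℂ) = -I * t + I * t * (‖x‖ ^ 2 : ℝ) by ring,
              Complex.exp_add]
            ring
    _ = _ := by
        rw [integral_integral_swap hprod]
        exact integral_congr_ae (Eventually.of_forall fun x => hinner x)

/-- Fourier inversion, with a Gaussian convergence factor: the integral of the amplitude need not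
converge absolutely when `m ≤ 2`. -/
theorem tendsto_integral_gaussian_mul_amplitude (γ : Fin m → ℝ) (hm : 1 ≤ m)
    (hθ : ∀ i, t₀ < θ i) :
    Tendsto (fun c : ℝ => (Real.pi : ℂ) ^ ((m : ℂ) / 2)
      * ∫ t : ℝ, cexp (-((4 * Real.pi ^ 2 * c)⁻¹ : ℝ) * t ^ 2)
          * (amplitude θ γ t₀ t * cexp (-I * t)))
      atTop (𝓝 (Real.pi * (Real.exp t₀ * normConst θ γ : ℝ))) := by
  have h := (Real.tendsto_integral_gaussian_smul' (integrable_sqNormDensity γ hm hθ)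
    (continuousAt_sqNormDensity θ γ t₀)).const_mul (2 * Real.pi : ℂ)
  rw [sqNormDensity_one] at h
  have heq : (2 * Real.pi : ℂ) * (1 / 2 * (Real.exp t₀ * normConst θ γ : ℝ))
      = Real.pi * (Real.exp t₀ * normConst θ γ : ℝ) := by ring
  rw [heq] at h
  refine h.congr' ?_
  filter_upwards [eventually_gt_atTop 0] with c hc
  have hpi := Real.pi_pos
  rw [integral_gaussian_mul_amplitude γ hm hθ (by positivity), ← integral_const_mul]
  refine integral_congr_ae (Eventually.of_forall fun u => ?_)
  simp only [Module.finrank_self, Nat.cast_one, smul_eq_mul]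
  have hpic : (0 : ℝ) ≤ Real.pi * c := by positivity
  have h1 : (Real.pi / ((4 * Real.pi ^ 2 * c)⁻¹ : ℝ) : ℂ) ^ (1 / 2 : ℂ)
      = 2 * Real.pi * (Real.pi * c : ℂ) ^ (1 / 2 : ℂ) := by
    have e1 : (Real.pi / ((4 * Real.pi ^ 2 * c)⁻¹ : ℝ) : ℂ)
        = ((((2 * Real.pi) ^ 2 : ℝ) : ℂ)) * ((Real.pi * c : ℝ) : ℂ) := by
      push_cast
      field_simp
      ring
    have e2 : (((2 * Real.pi) ^ 2 : ℝ) : ℂ) ^ (1 / 2 : ℂ) = 2 * Real.pi := by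
      have := ofReal_cpow (x := (2 * Real.pi) ^ 2) (by positivity) (1 / 2)
      rw [← Real.sqrt_eq_rpow, Real.sqrt_sq (by positivity)] at this
      push_cast at this ⊢
      exact this.symm
    rw [e1, mul_cpow_ofReal_nonneg (by positivity) hpic, e2]
    push_cast
    ring
  have h2 : -((u : ℂ) - 1) ^ 2 / (4 * (((4 * Real.pi ^ 2 * c)⁻¹ : ℝ) : ℂ))
      = -(Real.pi : ℂ) ^ 2 * c * ((‖1 - u‖ : ℝ) : ℂ) ^ 2 := by
    have : ((‖1 - u‖ : ℝ) : ℂ) ^ 2 = (1 - u : ℂ) ^ 2 := by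
      rw [Real.norm_eq_abs, ← ofReal_pow, sq_abs]
      push_cast
      rfl
    rw [this]
    push_cast
    field_simp
    ring
  rw [h1, h2]
  ring

end

/-! ### The hyperbolic contour -/

theorem one_add_sq_le_two_mul_cosh (x : ℝ) : 1 + x ^ 2 ≤ 2 * Real.cosh x := by
  have h1 := Real.cosh_sq x
  have h2 : x ^ 2 ≤ Real.sinh x ^ 2 := by
    rw [sq_le_sq, Real.abs_sinh]
    exact Real.self_le_sinh_iff.2 (abs_nonneg x)
  have h3 : Real.cosh (x / 2) ^ 2 = 1 + Real.sinh (x / 2) ^ 2 := by rw [Real.cosh_sq]; ring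
  have h4 : Real.cosh x = 1 + 2 * Real.sinh (x / 2) ^ 2 := by
    have := Real.cosh_two_mul (x / 2)
    rw [show 2 * (x / 2) = x by ring] at this
    linarith
  have h5 : (x / 2) ^ 2 ≤ Real.sinh (x / 2) ^ 2 := by
    rw [sq_le_sq, Real.abs_sinh]
    exact Real.self_le_sinh_iff.2 (abs_nonneg _)
  linarith [sq_nonneg x]

theorem exp_neg_le_two_div_sq {y : ℝ} (hy : 0 < y) : Real.exp (-y) ≤ 2 / y ^ 2 := by
  rw [Real.exp_neg, inv_le_comm₀ (Real.exp_pos _) (by positivity), inv_div]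
  linarith [Real.quadratic_le_exp_of_nonneg hy.le]

theorem exp_neg_mul_sinh_sq_le {α : ℝ} (hα : 0 < α) (x : ℝ) :
    Real.exp (-α * Real.sinh x ^ 2) ≤ (1 + 1 / α) / Real.cosh x ^ 2 := by
  have hs : 0 ≤ Real.sinh x ^ 2 := sq_nonneg _
  have hC : 0 < Real.cosh x ^ 2 := by have := Real.cosh_pos x; positivity
  have h1 : 1 + α * Real.sinh x ^ 2 ≤ Real.exp (α * Real.sinh x ^ 2) := by
    linarith [Real.add_one_le_exp (α * Real.sinh x ^ 2)]
  rw [neg_mul, Real.exp_neg, inv_le_comm₀ (Real.exp_pos _) (by positivity), inv_div]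
  refine le_trans ?_ h1
  rw [div_le_iff₀ (by positivity), Real.cosh_sq]
  have : (1 + α * Real.sinh x ^ 2) * (1 + 1 / α)
      = 1 + 1 / α + α * Real.sinh x ^ 2 + Real.sinh x ^ 2 := by
    field_simp
    ring
  rw [this]
  have : 0 < 1 / α := by positivity
  nlinarith

/-- The angle at which the integration contour leaves the real axis. Any angle slightly below `π/4`
would do: the Gaussian `exp (-t ^ 2)` still decays on the contour, and `exp (-I * t)` decays there
fast enough to compensate for the growth of the window. -/
noncomputable def contourAngle : ℝ := Real.arcsin (3 / 5)

theorem contourAngle_nonneg : 0 ≤ contourAngle := Real.arcsin_nonneg.2 (by norm_num)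

theorem sin_contourAngle : Real.sin contourAngle = 3 / 5 :=
  Real.sin_arcsin (by norm_num) (by norm_num)

theorem cos_contourAngle : Real.cos contourAngle = 4 / 5 := by
  rw [contourAngle, Real.cos_arcsin, show (1 : ℝ) - (3 / 5) ^ 2 = (4 / 5) ^ 2 by norm_num,
    Real.sqrt_sq (by norm_num)]

theorem sin_mem_of_mem_strip {y : ℝ} (hy : y ∈ Icc (-contourAngle) 0) :
    -(3 / 5) ≤ Real.sin y ∧ Real.sin y ≤ 0 := by
  have hle : contourAngle ≤ Real.pi / 2 := Real.arcsin_le_pi_div_two _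
  have hpi := Real.pi_pos
  constructor
  · rw [← sin_contourAngle, ← Real.sin_neg]
    exact Real.sin_le_sin_of_le_of_le_pi_div_two (by linarith) (by linarith [hy.2]) hy.1
  · rw [← Real.sin_zero]
    exact Real.sin_le_sin_of_le_of_le_pi_div_two (by linarith [hy.1]) (by linarith) hy.2

/-- The map `z ↦ d * sinh z` takes horizontal lines to hyperbolas with foci `± I * d`; it maps the
strip `-contourAngle ≤ Im z ≤ 0` to the region between the real line and a hyperbola that stays
above the singularities of the amplitude. -/
noncomputable def sinhMap (d : ℝ) (z : ℂ) : ℂ := d * Complex.sinh z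

theorem re_sinhMap (d x y : ℝ) : (sinhMap d (x + y * I)).re = d * (Real.sinh x * Real.cos y) := by
  rw [sinhMap, Complex.sinh_add, Complex.sinh_mul_I, Complex.cosh_mul_I, ← ofReal_sinh,
    ← ofReal_cosh, ← ofReal_sin, ← ofReal_cos]
  simp [-ofReal_sinh, -ofReal_cosh, -ofReal_sin, -ofReal_cos]

theorem im_sinhMap (d x y : ℝ) : (sinhMap d (x + y * I)).im = d * (Real.cosh x * Real.sin y) := by
  rw [sinhMap, Complex.sinh_add, Complex.sinh_mul_I, Complex.cosh_mul_I, ← ofReal_sinh,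
    ← ofReal_cosh, ← ofReal_sin, ← ofReal_cos]
  simp [-ofReal_sinh, -ofReal_cosh, -ofReal_sin, -ofReal_cos]

theorem norm_cosh_le (x y : ℝ) : ‖Complex.cosh (x + y * I)‖ ≤ Real.cosh x := by
  refine abs_le_of_sq_le_sq' ?_ (Real.cosh_pos x).le |>.2
  rw [← normSq_eq_norm_sq, normSq_apply, Complex.cosh_add, Complex.sinh_mul_I, Complex.cosh_mul_I,
    ← ofReal_sinh, ← ofReal_cosh, ← ofReal_sin, ← ofReal_cos]
  simp [-ofReal_sinh, -ofReal_cosh, -ofReal_sin, -ofReal_cos]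
  have h1 := Real.cosh_sq x
  have h2 := Real.sin_sq_add_cos_sq y
  nlinarith [sq_nonneg (Real.sin y)]

/-- On the strip the Gaussian `exp (-t ^ 2)`, with `t = d * sinh z`, decays at least like
`exp (-7 / 25 * d ^ 2 * sinh x ^ 2)`, because `Re (t ^ 2)` grows accordingly. -/
theorem re_sq_sub_im_sq_sinhMap_ge (d x : ℝ) {y : ℝ} (hy : y ∈ Icc (-contourAngle) 0) :
    7 / 25 * (d ^ 2 * Real.sinh x ^ 2) - 9 / 25 * d ^ 2
      ≤ (sinhMap d (x + y * I)).re ^ 2 - (sinhMap d (x + y * I)).im ^ 2 := by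
  obtain ⟨h1, h2⟩ := sin_mem_of_mem_strip hy
  rw [re_sinhMap, im_sinhMap]
  have h3 : Real.cos y ^ 2 = 1 - Real.sin y ^ 2 := Real.cos_sq' y
  have h4 : Real.sin y ^ 2 ≤ 9 / 25 := by nlinarith
  have h5 : (d * (Real.sinh x * Real.cos y)) ^ 2 - (d * (Real.cosh x * Real.sin y)) ^ 2
      = d ^ 2 * Real.sinh x ^ 2 * (1 - 2 * Real.sin y ^ 2) - d ^ 2 * Real.sin y ^ 2 := by
    rw [mul_pow, mul_pow, mul_pow, mul_pow, h3, Real.cosh_sq]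
    ring
  rw [h5]
  have h6 : 0 ≤ d ^ 2 * Real.sinh x ^ 2 := by positivity
  nlinarith [sq_nonneg d]

section amplitude

variable {m : ℕ} {θ : Fin m → ℝ} {t₀ d : ℝ}

theorem re_amplitude_base (i : Fin m) (t : ℂ) :
    ((θ i : ℂ) - I * t - t₀).re = θ i - t₀ + t.im := by
  simp
  ring

theorem im_amplitude_base (i : Fin m) (t : ℂ) :
    ((θ i : ℂ) - I * t - t₀).im = -t.re := by
  simp

/-- The branch points of the amplitude stay at distance at least `d / 5` from the region swept by
the deformation: either the imaginary part of `t` is above `-4 / 5 * d`, or its real part is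
large. -/
theorem amplitude_base_of_sinhMap (hd : 0 < d) (hθ : ∀ i, d ≤ θ i - t₀) (x : ℝ) {y : ℝ}
    (hy : y ∈ Icc (-contourAngle) 0) (i : Fin m) :
    (θ i : ℂ) - I * sinhMap d (x + y * I) - t₀ ∈ slitPlane
      ∧ d / 5 ≤ ‖(θ i : ℂ) - I * sinhMap d (x + y * I) - t₀‖ := by
  set w := (θ i : ℂ) - I * sinhMap d (x + y * I) - t₀ with hw
  have hre : w.re = θ i - t₀ + d * (Real.cosh x * Real.sin y) := by
    rw [hw, re_amplitude_base, im_sinhMap]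
  have him : w.im = -(d * (Real.sinh x * Real.cos y)) := by
    rw [hw, im_amplitude_base, re_sinhMap]
  obtain ⟨h1, h2⟩ := sin_mem_of_mem_strip hy
  rcases le_total (-(4 / 5)) (Real.cosh x * Real.sin y) with h | h
  · have h3 : d / 5 ≤ w.re := by
      rw [hre]
      nlinarith [hθ i]
    exact ⟨Or.inl (by linarith), h3.trans (re_le_norm w)⟩
  · have h3 : Real.cos y ^ 2 = 1 - Real.sin y ^ 2 := Real.cos_sq' y
    have h4 : Real.sin y ^ 2 ≤ 9 / 25 := by nlinarith
    have h5 : (4 / 5) ^ 2 ≤ (Real.cosh x * Real.sin y) ^ 2 := by nlinarith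
    have h6 : 16 / 9 ≤ Real.cosh x ^ 2 := by
      rw [mul_pow] at h5
      nlinarith [sq_nonneg (Real.cosh x)]
    rw [Real.cosh_sq] at h6
    have h7 : (1 / 5) ^ 2 ≤ (Real.sinh x * Real.cos y) ^ 2 := by
      rw [mul_pow, h3]
      nlinarith
    have h8 : 1 / 5 ≤ |Real.sinh x * Real.cos y| := by
      have := sq_le_sq.1 h7
      rwa [abs_of_pos (by norm_num : (0 : ℝ) < 1 / 5)] at this
    have h9 : d / 5 ≤ |w.im| := by
      rw [him, abs_neg, abs_mul, abs_of_pos hd]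
      nlinarith
    refine ⟨Or.inr fun h0 => ?_, h9.trans (abs_im_le_norm w)⟩
    rw [h0, abs_zero] at h9
    linarith

theorem amplitude_base_of_abs_im_le (hd : 0 < d) (hθ : ∀ i, d ≤ θ i - t₀) {t : ℂ}
    (ht : |t.im| ≤ d / 2) (i : Fin m) :
    (θ i : ℂ) - I * t - t₀ ∈ slitPlane ∧ d / 5 ≤ ‖(θ i : ℂ) - I * t - t₀‖ := by
  have h : d / 5 ≤ ((θ i : ℂ) - I * t - t₀).re := by
    rw [re_amplitude_base]
    linarith [hθ i, (abs_le.1 ht).1]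
  exact ⟨Or.inl (by linarith), h.trans (re_le_norm _)⟩

/-- A bound for the amplitude at distance at least `d / 5` from its singularities. -/
noncomputable def amplitudeBound {m : ℕ} (γ : Fin m → ℝ) (d : ℝ) : ℝ :=
  ∏ i, Real.exp (γ i ^ 2 / (4 * (d / 5))) / (d / 5) ^ (1 / 2 : ℝ)

theorem amplitudeBound_nonneg (γ : Fin m → ℝ) (hd : 0 < d) : 0 ≤ amplitudeBound γ d :=
  Finset.prod_nonneg fun i _ => by positivity

end amplitude

/-! ### Contour deformation -/

section

variable {m : ℕ} {θ : Fin m → ℝ} {t₀ d : ℝ}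

theorem norm_cexp_neg_I_mul (t : ℂ) : ‖cexp (-I * t)‖ = Real.exp t.im := by
  rw [norm_exp]
  simp

theorem differentiable_sinhMap (d : ℝ) : Differentiable ℂ (sinhMap d) := by
  unfold sinhMap
  fun_prop

theorem integral_eq_integral_sinhMap (hd : 0 < d) (g : ℂ → ℂ) :
    ∫ t : ℝ, g t = ∫ x : ℝ, g (sinhMap d x) * (d * Complex.cosh x) := by
  have himage : (fun x => d * Real.sinh x) '' univ = univ := by
    rw [image_univ]
    refine range_eq_univ.2 fun t => ⟨Real.arsinh (t / d), ?_⟩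
    simp only [Real.sinh_arsinh]
    field_simp
  have h := integral_image_eq_integral_abs_deriv_smul (s := univ) MeasurableSet.univ
    (f := fun x => d * Real.sinh x) (f' := fun x => d * Real.cosh x)
    (fun x _ => ((Real.hasDerivAt_sinh x).const_mul d).hasDerivWithinAt)
    (fun x _ y _ hxy => Real.sinh_injective (mul_left_cancel₀ hd.ne' hxy)) (fun t : ℝ => g t)
  rw [himage, setIntegral_univ, setIntegral_univ] at h
  rw [h]
  refine integral_congr_ae (Eventually.of_forall fun x => ?_)
  simp only
  rw [abs_of_pos (mul_pos hd (Real.cosh_pos x)), real_smul, sinhMap]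
  push_cast
  ring

/-- The integral of `G t * A(t) * exp (-I * t)` over the hyperbola that is the image of
`Im z = -contourAngle`. -/
noncomputable def contourIntegral (θ γ : Fin m → ℝ) (t₀ d : ℝ) (G : ℂ → ℂ) : ℂ :=
  ∫ x : ℝ, G (sinhMap d (x + (-contourAngle : ℝ) * I))
    * (complexAmplitude θ γ t₀ (sinhMap d (x + (-contourAngle : ℝ) * I))
      * cexp (-I * sinhMap d (x + (-contourAngle : ℝ) * I)))
    * (d * Complex.cosh (x + (-contourAngle : ℝ) * I))

theorem norm_complexAmplitude_sinhMap_le (γ : Fin m → ℝ) (hd : 0 < d)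
    (hθ : ∀ i, d ≤ θ i - t₀) (x : ℝ) {y : ℝ} (hy : y ∈ Icc (-contourAngle) 0) :
    ‖complexAmplitude θ γ t₀ (sinhMap d (x + y * I))‖ ≤ amplitudeBound γ d :=
  norm_complexAmplitude_le (by positivity) fun i => (amplitude_base_of_sinhMap hd hθ x hy i).2

theorem norm_contour_integrand_le (γ : Fin m → ℝ) (hd : 0 < d)
    (hθ : ∀ i, d ≤ θ i - t₀) (x : ℝ) {y : ℝ} (hy : y ∈ Icc (-contourAngle) 0) {g : ℂ} {K : ℝ}
    (hg : ‖g‖ * Real.exp (sinhMap d (x + y * I)).im ≤ K / Real.cosh x ^ 2) :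
    ‖g * (complexAmplitude θ γ t₀ (sinhMap d (x + y * I)) * cexp (-I * sinhMap d (x + y * I)))
        * (d * Complex.cosh (x + y * I))‖
      ≤ (2 * K * amplitudeBound γ d * d) / (1 + x ^ 2) := by
  have hA := norm_complexAmplitude_sinhMap_le γ hd hθ x hy
  have hA0 := amplitudeBound_nonneg γ hd
  have hC := Real.cosh_pos x
  have hK : 0 ≤ K / Real.cosh x ^ 2 := le_trans (by positivity) hg
  have hK0 : 0 ≤ K := by
    by_contra h
    exact absurd hK (not_le.2 (div_neg_of_neg_of_pos (not_le.1 h) (by positivity)))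
  calc _ = (‖g‖ * Real.exp (sinhMap d (x + y * I)).im)
        * ‖complexAmplitude θ γ t₀ (sinhMap d (x + y * I))‖ * (d * ‖Complex.cosh (x + y * I)‖) := by
        rw [norm_mul, norm_mul, norm_mul, norm_mul, norm_cexp_neg_I_mul, norm_real,
          Real.norm_of_nonneg hd.le]
        ring
    _ ≤ (K / Real.cosh x ^ 2) * amplitudeBound γ d * (d * Real.cosh x) := by
        gcongr
        exact norm_cosh_le x y
    _ = (K * amplitudeBound γ d * d) / Real.cosh x := by
        field_simp
    _ ≤ (K * amplitudeBound γ d * d) / ((1 + x ^ 2) / 2) := by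
        gcongr
        linarith [one_add_sq_le_two_mul_cosh x]
    _ = _ := by
        field_simp

theorem im_sinhMap_nonpos (hd : 0 < d) (x : ℝ) {y : ℝ} (hy : y ∈ Icc (-contourAngle) 0) :
    (sinhMap d (x + y * I)).im ≤ 0 := by
  rw [im_sinhMap]
  have h := (sin_mem_of_mem_strip hy).2
  have hC := (Real.cosh_pos x).le
  exact mul_nonpos_of_nonneg_of_nonpos hd.le (mul_nonpos_of_nonneg_of_nonpos hC h)

theorem differentiableAt_contour_integrand (γ : Fin m → ℝ) (hd : 0 < d)
    (hθ : ∀ i, d ≤ θ i - t₀) {G : ℂ → ℂ} (hG : Differentiable ℂ G) (x : ℝ) {y : ℝ}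
    (hy : y ∈ Icc (-contourAngle) 0) :
    DifferentiableAt ℂ (fun z => G (sinhMap d z) * (complexAmplitude θ γ t₀ (sinhMap d z)
      * cexp (-I * sinhMap d z)) * (d * Complex.cosh z)) (x + y * I) := by
  have h1 : DifferentiableAt ℂ (fun z => complexAmplitude θ γ t₀ (sinhMap d z)) (x + y * I) :=
    (differentiableAt_complexAmplitude fun i =>
      (amplitude_base_of_sinhMap hd hθ x hy i).1).comp _ (differentiable_sinhMap d _)
  have h2 : Differentiable ℂ fun z => G (sinhMap d z) := hG.comp (differentiable_sinhMap d)
  have h3 := differentiable_sinhMap d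
  fun_prop

/-- Deformation of the real line to the hyperbola. -/
theorem integral_eq_contourIntegral (γ : Fin m → ℝ) (hd : 0 < d) (hθ : ∀ i, d ≤ θ i - t₀)
    {G : ℂ → ℂ} (hG : Differentiable ℂ G) {K : ℝ}
    (hK : ∀ x y : ℝ, y ∈ Icc (-contourAngle) 0 →
      ‖G (sinhMap d (x + y * I))‖ ≤ K / Real.cosh x ^ 2) :
    ∫ t : ℝ, G t * (complexAmplitude θ γ t₀ t * cexp (-I * t)) = contourIntegral θ γ t₀ d G := by
  have hneg : -contourAngle ≤ 0 := neg_nonpos.2 contourAngle_nonneg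
  rw [integral_eq_integral_sinhMap hd
    (fun t => G t * (complexAmplitude θ γ t₀ t * cexp (-I * t)))]
  have := integral_line_eq_of_strip (f := fun z => G (sinhMap d z) *
      (complexAmplitude θ γ t₀ (sinhMap d z) * cexp (-I * sinhMap d z)) * (d * Complex.cosh z))
    hneg (fun x y hy => differentiableAt_contour_integrand γ hd hθ hG x hy)
    (fun x y hy => norm_contour_integrand_le (K := K) γ hd hθ x hy ?_)
  · rw [contourIntegral, this]
    simp
  · refine le_trans ?_ (hK x y hy)
    exact mul_le_of_le_one_right (norm_nonneg _) (Real.exp_le_one_iff.2 (im_sinhMap_nonpos hd x hy))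

theorem norm_cexp_neg_mul_sq (ε : ℝ) (t : ℂ) :
    ‖cexp (-ε * t ^ 2)‖ = Real.exp (-ε * (t.re ^ 2 - t.im ^ 2)) := by
  rw [norm_exp]
  congr 1
  simp [sq]

theorem norm_gaussian_sinhMap_le (hd : 0 < d) {ε : ℝ} (hε : 0 < ε) (x : ℝ) {y : ℝ}
    (hy : y ∈ Icc (-contourAngle) 0) :
    ‖cexp (-ε * sinhMap d (x + y * I) ^ 2)‖
      ≤ (Real.exp (ε * (9 / 25 * d ^ 2)) * (1 + 1 / (ε * (7 / 25 * d ^ 2)))) / Real.cosh x ^ 2 := by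
  have h1 := exp_neg_mul_sinh_sq_le (α := ε * (7 / 25 * d ^ 2)) (by positivity) x
  rw [norm_cexp_neg_mul_sq, mul_div_assoc]
  refine le_trans ?_ (mul_le_mul_of_nonneg_left h1 (Real.exp_pos _).le)
  rw [← Real.exp_add]
  refine Real.exp_le_exp.2 ?_
  nlinarith [re_sq_sub_im_sq_sinhMap_ge d x hy]

theorem neg_contourAngle_mem : -contourAngle ∈ Icc (-contourAngle) 0 :=
  ⟨le_rfl, neg_nonpos.2 contourAngle_nonneg⟩

theorem im_sinhMap_contour (d x : ℝ) :
    (sinhMap d (x + (-contourAngle : ℝ) * I)).im = -(3 / 5 * d * Real.cosh x) := by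
  rw [im_sinhMap, Real.sin_neg, sin_contourAngle]
  ring

theorem re_sinhMap_contour (d x : ℝ) :
    (sinhMap d (x + (-contourAngle : ℝ) * I)).re = 4 / 5 * d * Real.sinh x := by
  rw [re_sinhMap, Real.cos_neg, cos_contourAngle]
  ring

theorem exp_im_sinhMap_contour_le (hd : 0 < d) (x : ℝ) :
    Real.exp (sinhMap d (x + (-contourAngle : ℝ) * I)).im ≤ (6 / d ^ 2) / Real.cosh x ^ 2 := by
  have hC := Real.cosh_pos x
  rw [im_sinhMap_contour]
  refine (exp_neg_le_two_div_sq (by positivity)).trans ?_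
  rw [div_div, mul_pow, mul_pow, div_le_div_iff₀ (by positivity) (by positivity)]
  have : 0 < d ^ 2 * Real.cosh x ^ 2 := by positivity
  nlinarith

theorem continuous_contour_integrand (γ : Fin m → ℝ) (hd : 0 < d)
    (hθ : ∀ i, d ≤ θ i - t₀) {G : ℂ → ℂ} (hG : Differentiable ℂ G) :
    Continuous fun x : ℝ => G (sinhMap d (x + (-contourAngle : ℝ) * I))
    * (complexAmplitude θ γ t₀ (sinhMap d (x + (-contourAngle : ℝ) * I))
      * cexp (-I * sinhMap d (x + (-contourAngle : ℝ) * I)))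
    * (d * Complex.cosh (x + (-contourAngle : ℝ) * I)) :=
  continuous_on_line (f := fun z => G (sinhMap d z) * (complexAmplitude θ γ t₀ (sinhMap d z)
      * cexp (-I * sinhMap d z)) * (d * Complex.cosh z))
    fun x => differentiableAt_contour_integrand γ hd hθ hG x neg_contourAngle_mem

/-- On the hyperbola the inversion integral converges absolutely, so that the Gaussian convergence
factor can be removed. -/
theorem contourIntegral_one (γ : Fin m → ℝ) (hm : 1 ≤ m) (hd : 0 < d)
    (hθ : ∀ i, d ≤ θ i - t₀) :
    (Real.pi : ℂ) ^ ((m : ℂ) / 2) * contourIntegral θ γ t₀ d (fun _ => 1)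
      = Real.pi * (Real.exp t₀ * normConst θ γ : ℝ) := by
  have hlim := tendsto_integral_gaussian_mul_amplitude γ hm
    (fun i => (by linarith [hθ i] : t₀ < θ i))
  refine tendsto_nhds_unique (Tendsto.const_mul _ ?_) hlim
  have hε : Tendsto (fun c : ℝ => (4 * Real.pi ^ 2 * c)⁻¹) atTop (𝓝 0) :=
    tendsto_inv_atTop_zero.comp (tendsto_id.const_mul_atTop (by positivity))
  have hεC : Tendsto (fun c : ℝ => (((4 * Real.pi ^ 2 * c)⁻¹ : ℝ) : ℂ)) atTop (𝓝 0) := by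
    have := (continuous_ofReal.tendsto 0).comp hε
    rwa [ofReal_zero] at this
  have hG : ∀ ε : ℝ, Differentiable ℂ fun t : ℂ => cexp (-ε * t ^ 2) := fun ε => by fun_prop
  have hDCT : Tendsto (fun c : ℝ => contourIntegral θ γ t₀ d
      fun t => cexp (-((4 * Real.pi ^ 2 * c)⁻¹ : ℝ) * t ^ 2)) atTop
      (𝓝 (contourIntegral θ γ t₀ d fun _ => 1)) := by
    refine tendsto_integral_filter_of_dominated_convergence
      (fun x => (2 * (Real.exp (9 / 25 * d ^ 2) * (6 / d ^ 2)) * amplitudeBound γ d * d)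
        / (1 + x ^ 2)) ?_ ?_ (integrable_div_one_add_sq _) ?_
    · exact Eventually.of_forall fun c =>
        (continuous_contour_integrand γ hd hθ (hG _)).aestronglyMeasurable
    · filter_upwards [eventually_gt_atTop 0, hε.eventually (gt_mem_nhds zero_lt_one)] with c hc hc1
      refine Eventually.of_forall fun x => ?_
      refine norm_contour_integrand_le γ hd hθ x neg_contourAngle_mem ?_
      rw [mul_div_assoc]
      refine mul_le_mul ?_ (exp_im_sinhMap_contour_le hd x) (Real.exp_pos _).le (Real.exp_pos _).le
      rw [norm_cexp_neg_mul_sq]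
      refine Real.exp_le_exp.2 ?_
      have h1 := re_sq_sub_im_sq_sinhMap_ge d x neg_contourAngle_mem
      have h2 : 0 ≤ d ^ 2 * Real.sinh x ^ 2 := by positivity
      have h3 : 0 < (4 * Real.pi ^ 2 * c)⁻¹ := by positivity
      nlinarith [sq_nonneg d]
    · refine Eventually.of_forall fun x => Tendsto.mul_const _ (Tendsto.mul_const _ ?_)
      have : Tendsto (fun c : ℝ => cexp (-((4 * Real.pi ^ 2 * c)⁻¹ : ℝ)
          * sinhMap d (x + (-contourAngle : ℝ) * I) ^ 2)) atTop
          (𝓝 (cexp (-0 * sinhMap d (x + (-contourAngle : ℝ) * I) ^ 2))) :=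
        (Complex.continuous_exp.tendsto _).comp (hεC.neg.mul_const _)
      simpa using this
  refine hDCT.congr' ?_
  filter_upwards [eventually_gt_atTop 0] with c hc
  exact (integral_eq_contourIntegral γ hd hθ (hG _)
    fun x y hy => norm_gaussian_sinhMap_le hd (by positivity) x hy).symm

/-! ### Estimates for the smooth window -/

theorem norm_smoothWindow_le {p q : ℝ} (hp : 0 < p) (hq : 0 ≤ q) (t : ℂ) :
    ‖smoothWindow p q t‖ ≤ (if |t.re| ≤ p * q then 1 else 0)
      + 2 * Real.exp ((t.im / p) ^ 2 - (|t.re| / p - q) ^ 2) := by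
  split_ifs with h
  · have := norm_smoothWindow_le_of_re_le hp hq h
    have h2 := norm_sub_le (1 : ℂ) (1 - smoothWindow p q t)
    rw [sub_sub_cancel, norm_one] at h2
    linarith
  · rw [zero_add]
    exact norm_smoothWindow_le_of_le_re hp hq (not_le.1 h).le

theorem norm_one_sub_smoothWindow_le {p q : ℝ} (hp : 0 < p) (hq : 0 ≤ q) (t : ℂ) :
    ‖1 - smoothWindow p q t‖ ≤ (if p * q < |t.re| then 1 else 0)
      + 2 * Real.exp ((t.im / p) ^ 2 - (|t.re| / p - q) ^ 2) := by
  split_ifs with h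
  · have := norm_smoothWindow_le_of_le_re hp hq h.le
    have h2 := norm_sub_le (1 : ℂ) (smoothWindow p q t)
    rw [norm_one] at h2
    linarith
  · rw [zero_add]
    exact norm_smoothWindow_le_of_re_le hp hq (not_lt.1 h)

/-- The smooth window decays on the strip that is swept by the deformation of the contour. -/
theorem norm_smoothWindow_sinhMap_le (hd : 0 < d) {p q : ℝ} (hp : 0 < p) (hq : 0 ≤ q) (x : ℝ)
    {y : ℝ} (hy : y ∈ Icc (-contourAngle) 0) :
    ‖smoothWindow p q (sinhMap d (x + y * I))‖
      ≤ ((1 + (5 * (p * q) / (4 * d)) ^ 2) + 2 * (Real.exp (9 / 25 * d ^ 2 / p ^ 2 + 8 * q ^ 2)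
        * (1 + 1 / (7 / 50 * d ^ 2 / p ^ 2)))) / Real.cosh x ^ 2 := by
  have hC : 0 < Real.cosh x ^ 2 := by have := Real.cosh_pos x; positivity
  obtain ⟨h1, h2⟩ := sin_mem_of_mem_strip hy
  have hcos0 : 0 ≤ Real.cos y := by
    have hle : contourAngle ≤ Real.pi / 2 := Real.arcsin_le_pi_div_two _
    exact Real.cos_nonneg_of_mem_Icc ⟨by linarith [hy.1], by linarith [hy.2, Real.pi_pos]⟩
  have hcos : 4 / 5 ≤ Real.cos y := by nlinarith [Real.sin_sq_add_cos_sq y]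
  have hcos1 := Real.cos_le_one y
  have hre : |(sinhMap d (x + y * I)).re| = d * (|Real.sinh x| * Real.cos y) := by
    rw [re_sinhMap, abs_mul, abs_mul, abs_of_pos hd, abs_of_nonneg hcos0]
  have hsC : Real.cosh x ^ 2 = 1 + |Real.sinh x| ^ 2 := by rw [sq_abs, Real.cosh_sq]; ring
  refine (norm_smoothWindow_le hp hq _).trans ?_
  rw [add_div, mul_div_assoc 2]
  refine add_le_add ?_ (mul_le_mul_of_nonneg_left ?_ zero_le_two)
  · split_ifs with h
    · rw [le_div_iff₀ hC, one_mul, hsC]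
      rw [hre] at h
      have h3 : |Real.sinh x| ≤ 5 * (p * q) / (4 * d) := by
        rw [le_div_iff₀ (by positivity)]
        have h4 : 0 ≤ d * |Real.sinh x| := by positivity
        nlinarith
      gcongr
    · positivity
  · have h3 := exp_neg_mul_sinh_sq_le (α := 7 / 50 * d ^ 2 / p ^ 2) (by positivity) x
    rw [mul_div_assoc]
    refine le_trans ?_ (mul_le_mul_of_nonneg_left h3 (Real.exp_pos _).le)
    rw [← Real.exp_add]
    refine Real.exp_le_exp.2 ?_
    have h4 := re_sq_sub_im_sq_sinhMap_ge d x hy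
    set X := (sinhMap d (x + y * I)).re with hX
    set Y := (sinhMap d (x + y * I)).im with hY
    have h5 : |X| / p ≤ d * |Real.sinh x| / p := by
      rw [hre]
      have : |Real.sinh x| * Real.cos y ≤ |Real.sinh x| :=
        mul_le_of_le_one_right (abs_nonneg _) hcos1
      gcongr
    have h6 : (Y / p) ^ 2 - (|X| / p - q) ^ 2
        = -((X ^ 2 - Y ^ 2) / p ^ 2) + 2 * (|X| / p) * q - q ^ 2 := by
      rw [← sq_abs X]
      field_simp
      ring
    have h7 : (7 / 25 * (d ^ 2 * Real.sinh x ^ 2) - 9 / 25 * d ^ 2) / p ^ 2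
        ≤ (X ^ 2 - Y ^ 2) / p ^ 2 := by gcongr
    have h8 : (7 / 25 * (d ^ 2 * Real.sinh x ^ 2) - 9 / 25 * d ^ 2) / p ^ 2
        = 7 / 25 * (d * |Real.sinh x| / p) ^ 2 - 9 / 25 * d ^ 2 / p ^ 2 := by
      rw [← sq_abs (Real.sinh x)]
      field_simp
    have h9 : -(7 / 50 * d ^ 2 / p ^ 2) * Real.sinh x ^ 2
        = -(7 / 50) * (d * |Real.sinh x| / p) ^ 2 := by
      rw [← sq_abs (Real.sinh x)]
      field_simp
    rw [h6, h9]
    set v := d * |Real.sinh x| / p with hv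
    have h10 : |X| / p * q ≤ v * q := by gcongr
    nlinarith [sq_nonneg (v * (7 / 50) - q)]

/-- The smooth window on horizontal lines: the constant is polynomial in `p` and `q`. -/
theorem norm_smoothWindow_line_le {p q b : ℝ} (hp : 0 < p) (hq : 0 ≤ q) {t : ℂ}
    (ht : |t.im| ≤ b) :
    ‖smoothWindow p q t‖ ≤ ((1 + p ^ 2 * q ^ 2) + 2 * (Real.exp (b ^ 2 / p ^ 2)
      * (1 + 2 * p ^ 2 * q ^ 2 + 2 * p ^ 2))) / (1 + t.re ^ 2) := by
  have h1 : 0 < 1 + t.re ^ 2 := by positivity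
  refine (norm_smoothWindow_le hp hq _).trans ?_
  rw [add_div, mul_div_assoc 2]
  refine add_le_add ?_ (mul_le_mul_of_nonneg_left ?_ zero_le_two)
  · split_ifs with h
    · rw [le_div_iff₀ h1, one_mul, ← mul_pow, ← sq_abs t.re]
      gcongr
    · positivity
  · rw [sub_eq_add_neg, Real.exp_add,
        mul_div_assoc]
    have h2 : (t.im / p) ^ 2 ≤ b ^ 2 / p ^ 2 := by
      rw [div_pow, ← sq_abs t.im]
      gcongr
    refine mul_le_mul (Real.exp_le_exp.2 h2) ?_ (Real.exp_pos _).le (Real.exp_pos _).le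
    set v := |t.re| / p - q with hv
    have h3 : |t.re| = p * (v + q) := by
      rw [hv]
      field_simp
      ring
    have h4 : t.re ^ 2 ≤ 2 * p ^ 2 * v ^ 2 + 2 * p ^ 2 * q ^ 2 := by
      rw [← sq_abs, h3, mul_pow]
      nlinarith [mul_nonneg (sq_nonneg p) (sq_nonneg (v - q))]
    have h5 : Real.exp (-v ^ 2) ≤ 1 / (1 + v ^ 2) := by
      rw [Real.exp_neg, inv_eq_one_div]
      gcongr
      linarith [Real.add_one_le_exp (v ^ 2)]
    refine h5.trans ?_
    rw [div_le_div_iff₀ (by positivity) h1]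
    nlinarith [mul_nonneg (sq_nonneg p) (sq_nonneg q), mul_nonneg (sq_nonneg p)
      (mul_nonneg (sq_nonneg q) (sq_nonneg v)), sq_nonneg p, sq_nonneg v]

/-- On the hyperbola the window may be replaced by `1`: `1 - W` is of size `exp (-q ^ 2)` near the
origin and grows no faster than `exp (-I * t)` decays. The factor `2 / 3` is the price for a contour
angle below `π / 4`. -/
theorem norm_one_sub_smoothWindow_contour_le (hd : 0 < d) {p q ω R : ℝ} (hp : 0 < p) (hω : 0 < ω)
    (hω1 : ω ≤ 1) (hq : q = ω * p / 2) (hR : R ≤ 2 / 3 * q ^ 2) (x : ℝ) :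
    ‖1 - smoothWindow p q (sinhMap d (x + (-contourAngle : ℝ) * I))‖
      * Real.exp (sinhMap d (x + (-contourAngle : ℝ) * I)).im
      ≤ (Real.exp (-R) * (23 / d ^ 2 + 2 * Real.exp (9 / 25 * d ^ 2 / p ^ 2)
        * (1 + 25 * p ^ 2 / d ^ 2))) / Real.cosh x ^ 2 := by
  have hq0 : 0 < q := by rw [hq]; positivity
  have hC := Real.cosh_pos x
  have hbound := norm_one_sub_smoothWindow_le hp hq0.le (sinhMap d (x + (-contourAngle : ℝ) * I))
  have hre := re_sinhMap_contour d x
  have him := im_sinhMap_contour d x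
  set X := (sinhMap d (x + (-contourAngle : ℝ) * I)).re with hX
  set Y := 3 / 5 * d * Real.cosh x with hY
  rw [him, neg_div, neg_sq] at hbound
  rw [him]
  have hYX : 3 / 4 * |X| ≤ Y := by
    rw [hre, hY, abs_mul, abs_of_pos (by positivity : (0 : ℝ) < 4 / 5 * d)]
    have : |Real.sinh x| ≤ Real.cosh x := by
      refine abs_le_of_sq_le_sq ?_ hC.le
      rw [Real.cosh_sq]
      linarith
    nlinarith
  refine (mul_le_mul_of_nonneg_right hbound (Real.exp_pos _).le).trans ?_
  rw [add_mul, mul_add, add_div]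
  refine add_le_add ?_ ?_
  · split_ifs with h
    · have h1 : R ≤ Y / 2 := by
        have h2 : p * q * ω = 2 * q ^ 2 := by rw [hq]; ring
        have h3 : p * q * ω ≤ p * q := mul_le_of_le_one_right (by positivity) hω1
        nlinarith [sq_nonneg q]
      have h2 : Real.exp (-(Y / 2)) ≤ (23 / d ^ 2) / Real.cosh x ^ 2 := by
        refine (exp_neg_le_two_div_sq (by positivity)).trans ?_
        rw [hY, div_div, div_le_div_iff₀ (by positivity) (by positivity)]
        have : 0 < d ^ 2 * Real.cosh x ^ 2 := by positivity
        nlinarith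
      have h3 : Real.exp (-(Y / 2)) ≤ Real.exp (-R) := Real.exp_le_exp.2 (by linarith)
      rw [one_mul, show -Y = -(Y / 2) + -(Y / 2) by ring, Real.exp_add,
        mul_div_assoc (Real.exp (-R))]
      exact mul_le_mul h3 h2 (Real.exp_pos _).le (Real.exp_pos _).le
    · rw [zero_mul]
      positivity
  · have h3 := exp_neg_mul_sinh_sq_le (α := d ^ 2 / (25 * p ^ 2)) (by positivity) x
    rw [one_div_div] at h3
    calc 2 * Real.exp ((Y / p) ^ 2 - (|X| / p - q) ^ 2) * Real.exp (-Y)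
        ≤ 2 * (Real.exp (-R) * Real.exp (9 / 25 * d ^ 2 / p ^ 2)
          * Real.exp (-(d ^ 2 / (25 * p ^ 2)) * Real.sinh x ^ 2)) := by
          rw [mul_assoc, ← Real.exp_add, ← Real.exp_add, ← Real.exp_add]
          refine mul_le_mul_of_nonneg_left (Real.exp_le_exp.2 ?_) zero_le_two
          have h4 : (Y / p) ^ 2 = 9 / 16 * (|X| / p) ^ 2 + 9 / 25 * d ^ 2 / p ^ 2 := by
            rw [hre, hY, div_pow (|_|), sq_abs, div_pow, mul_pow, Real.cosh_sq]
            field_simp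
            ring
          have h5 : -(d ^ 2 / (25 * p ^ 2)) * Real.sinh x ^ 2 = -(1 / 16) * (|X| / p) ^ 2 := by
            rw [hre, div_pow, sq_abs]
            field_simp
            ring
          have h6 : |X| = p * (|X| / p) := by field_simp
          rw [h4, h5]
          rw [h6] at hYX
          set v := |X| / p with hv
          have hv0 : 0 ≤ v := by positivity
          have h7 : 3 / 4 * ω * (p * v) ≤ Y := by
            refine le_trans ?_ hYX
            have : ω * (p * v) ≤ p * v := mul_le_of_le_one_left (by positivity) hω1
            linarith
          have h8 : 2 * v * q = ω * (p * v) := by rw [hq]; ring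
          -- The two squares balance exactly: `ω p v / 4 ≤ 3 v ^ 2 / 8 + ω ^ 2 p ^ 2 / 24`.
          have h9 : 1 / 4 * (ω * (p * v)) ≤ 3 / 8 * v ^ 2 + 1 / 3 * q ^ 2 * (1 / 2) := by
            rw [hq]
            nlinarith [sq_nonneg (3 * v - ω * p)]
          nlinarith [sq_nonneg q]
      _ ≤ 2 * (Real.exp (-R) * Real.exp (9 / 25 * d ^ 2 / p ^ 2)
          * ((1 + 25 * p ^ 2 / d ^ 2) / Real.cosh x ^ 2)) := by gcongr
      _ = _ := by ring

/-- The error committed by inserting the smooth window into the inversion integral. -/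
theorem norm_contourIntegral_sub_le (γ : Fin m → ℝ) (hd : 0 < d)
    (hθ : ∀ i, d ≤ θ i - t₀) {p q ω R : ℝ} (hp : 0 < p) (hω : 0 < ω)
    (hω1 : ω ≤ 1) (hq : q = ω * p / 2) (hR : R ≤ 2 / 3 * q ^ 2) :
    ‖contourIntegral θ γ t₀ d (fun _ => 1) - contourIntegral θ γ t₀ d (smoothWindow p q)‖
      ≤ Real.pi * (2 * (Real.exp (-R) * (23 / d ^ 2 + 2 * Real.exp (9 / 25 * d ^ 2 / p ^ 2)
        * (1 + 25 * p ^ 2 / d ^ 2))) * amplitudeBound γ d * d) := by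
  have hq0 : 0 ≤ q := by rw [hq]; positivity
  have hi : ∀ {G : ℂ → ℂ} {K : ℝ}, Differentiable ℂ G →
      (∀ x : ℝ, ‖G (sinhMap d (x + (-contourAngle : ℝ) * I))‖
        * Real.exp (sinhMap d (x + (-contourAngle : ℝ) * I)).im ≤ K / Real.cosh x ^ 2) →
      Integrable fun x : ℝ => G (sinhMap d (x + (-contourAngle : ℝ) * I))
        * (complexAmplitude θ γ t₀ (sinhMap d (x + (-contourAngle : ℝ) * I))
        * cexp (-I * sinhMap d (x + (-contourAngle : ℝ) * I)))
        * (d * Complex.cosh (x + (-contourAngle : ℝ) * I)) := fun hG hK =>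
    integrable_of_norm_le_div_one_add_sq (continuous_contour_integrand γ hd hθ hG)
      fun x => norm_contour_integrand_le γ hd hθ x neg_contourAngle_mem (hK x)
  have h1 := hi (G := fun _ => 1) (by fun_prop) (fun x => by
    rw [norm_one, one_mul]
    exact exp_im_sinhMap_contour_le hd x)
  have h2 := hi (differentiable_smoothWindow p q) fun x =>
    (mul_le_of_le_one_right (norm_nonneg _)
      (Real.exp_le_one_iff.2 (im_sinhMap_nonpos hd x neg_contourAngle_mem))).trans
    (norm_smoothWindow_sinhMap_le hd hp hq0 x neg_contourAngle_mem)
  rw [contourIntegral, contourIntegral, ← integral_sub h1 h2]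
  refine norm_integral_le_of_norm_le_div_one_add_sq fun x => ?_
  rw [← sub_mul, ← sub_mul]
  exact norm_contour_integrand_le γ hd hθ x neg_contourAngle_mem
    (norm_one_sub_smoothWindow_contour_le hd hp hω hω1 hq hR x)

/-- The trapezoidal rule for the inversion integral with the smooth window. -/
theorem norm_trapezoidal_sub_contourIntegral_le (γ : Fin m → ℝ) (hd : 0 < d)
    (hθ : ∀ i, d ≤ θ i - t₀) {p q h : ℝ} (hp : 0 < p) (hq : 0 ≤ q) (hh : 0 < h) :
    ‖(h : ℂ) * ∑' n : ℤ, smoothWindow p q ((n * h : ℝ) : ℂ)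
        * (amplitude θ γ t₀ (n * h) * cexp (-I * ((n * h : ℝ) : ℂ)))
      - contourIntegral θ γ t₀ d (smoothWindow p q)‖
      ≤ 2 * (Real.pi * (((1 + p ^ 2 * q ^ 2) + 2 * (Real.exp ((d / 2) ^ 2 / p ^ 2)
      * (1 + 2 * p ^ 2 * q ^ 2 + 2 * p ^ 2))) * amplitudeBound γ d * Real.exp (d / 2)))
      * (Real.exp (-(Real.pi * d / h)) / (1 - Real.exp (-(Real.pi * d / h)))) := by
  rw [← integral_eq_contourIntegral γ hd hθ (differentiable_smoothWindow p q)
    fun x y hy => norm_smoothWindow_sinhMap_le hd hp hq x hy]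
  have key := norm_trapezoidal_sub_integral_le (f := fun t => smoothWindow p q t
    * (complexAmplitude θ γ t₀ t * cexp (-I * t))) (b := d / 2) (h := h)
    (M := ((1 + p ^ 2 * q ^ 2) + 2 * (Real.exp ((d / 2) ^ 2 / p ^ 2)
      * (1 + 2 * p ^ 2 * q ^ 2 + 2 * p ^ 2))) * amplitudeBound γ d * Real.exp (d / 2))
    (by positivity) hh (fun x y hy => ?_) (fun x y hy => ?_)
  · rw [show 2 * Real.pi * (d / 2) / h = Real.pi * d / h by ring] at key
    exact key
  · have h1 : DifferentiableAt ℂ (complexAmplitude θ γ t₀) (x + y * I) :=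
      differentiableAt_complexAmplitude fun i =>
        (amplitude_base_of_abs_im_le hd hθ (by simpa using hy) i).1
    have h2 := differentiable_smoothWindow p q
    fun_prop
  · have h1 := norm_smoothWindow_line_le hp hq (t := x + y * I) (b := d / 2) (by simpa using hy)
    have h2 : ‖complexAmplitude θ γ t₀ (x + y * I)‖ ≤ amplitudeBound γ d :=
      norm_complexAmplitude_le (by positivity) fun i =>
        (amplitude_base_of_abs_im_le hd hθ (by simpa using hy) i).2
    have h3 : ‖cexp (-I * (x + y * I))‖ ≤ Real.exp (d / 2) := by
      rw [norm_cexp_neg_I_mul]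
      refine Real.exp_le_exp.2 ?_
      simpa using (abs_le.1 hy).2
    have hre : ((x : ℂ) + y * I).re = x := by simp
    rw [hre] at h1
    have hA0 := amplitudeBound_nonneg γ hd
    rw [norm_mul, norm_mul]
    refine (mul_le_mul h1 (mul_le_mul h2 h3 (norm_nonneg _) hA0) (by positivity)
      (le_trans (norm_nonneg _) h1)).trans (le_of_eq (by ring))

/-! ### The truncated sum and the three contributions to the error -/

theorem summable_one_div_one_add_int_sq : Summable fun n : ℤ => 1 / (1 + (n : ℝ) ^ 2) := by
  refine Summable.of_norm_bounded_eventually (Real.summable_one_div_int_pow.2 one_lt_two) ?_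
  filter_upwards [(Set.finite_singleton (0 : ℤ)).compl_mem_cofinite] with n hn
  have hn0 : (n : ℝ) ≠ 0 := by exact_mod_cast hn
  have : 0 < (n : ℝ) ^ 2 := by positivity
  rw [Real.norm_of_nonneg (by positivity)]
  gcongr
  linarith

theorem exp_neg_mul_abs_le {κ : ℝ} (hκ : 0 < κ) (n : ℝ) :
    Real.exp (-(κ * |n|)) ≤ (1 + 2 / κ ^ 2) / (1 + n ^ 2) := by
  rw [le_div_iff₀ (by positivity), mul_add, mul_one]
  refine add_le_add (Real.exp_le_one_iff.2 (neg_nonpos.2 (by positivity))) ?_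
  rcases eq_or_ne n 0 with rfl | hn
  · simp
    positivity
  · have hn' : 0 < |n| := abs_pos.2 hn
    have := exp_neg_le_two_div_sq (y := κ * |n|) (by positivity)
    rw [mul_pow, sq_abs] at this
    rw [← le_div_iff₀ (by positivity)]
    refine this.trans (le_of_eq ?_)
    field_simp

theorem window_sub_smoothWindow (p q x : ℝ) :
    ((window |x| p q : ℝ) : ℂ) - smoothWindow p q x = gaussTail (((|x| : ℝ) : ℂ) / p + q) := by
  have h : smoothWindow p q x = smoothWindow p q ((|x| : ℝ) : ℂ) := by
    rcases abs_choice x with h | h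
    · rw [h]
    · rw [h, ofReal_neg, smoothWindow_neg]
  rw [h, window_eq_gaussTail, smoothWindow]
  push_cast
  ring

/-- Replacing the truncated sum with the window `w(|x|; p, q)` by the full sum with the smooth
window. -/
theorem norm_sum_window_sub_tsum_le {p q h A : ℝ} {N : ℕ} (hp : 0 < p) (hq : 0 < q) (hh : 0 < h)
    (hN : N * h = 2 * p * q) {a : ℤ → ℂ} (ha : ∀ n, ‖a n‖ ≤ A) :
    ‖∑ n ∈ Finset.Icc (-(N : ℤ) - 1) (N : ℤ), ((window |(n : ℝ) * h| p q : ℝ) : ℂ) * a n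
      - ∑' n : ℤ, smoothWindow p q ((n * h : ℝ) : ℂ) * a n‖
    ≤ Real.exp (-q ^ 2) * (1 + (N + 1 : ℝ) ^ 2 + 2 * (1 + 2 / (h ^ 2 / p ^ 2) ^ 2)) * A
      * ∑' n : ℤ, 1 / (1 + (n : ℝ) ^ 2) := by
  set s := Finset.Icc (-(N : ℤ) - 1) (N : ℤ) with hs
  set B : ℝ := 1 + (N + 1 : ℝ) ^ 2 + 2 * (1 + 2 / (h ^ 2 / p ^ 2) ^ 2) with hB
  set w : ℤ → ℂ := fun n => if n ∈ s then ((window |(n : ℝ) * h| p q : ℝ) : ℂ) * a n else 0 with hw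
  have hws : HasSum w (∑ n ∈ s, ((window |(n : ℝ) * h| p q : ℝ) : ℂ) * a n) := by
    have : HasSum w (∑ n ∈ s, w n) :=
      hasSum_sum_of_ne_finset_zero fun n hn => by simp [hw, hn]
    rwa [Finset.sum_congr rfl fun n hn => (by simp [hw, hn] :
      w n = ((window |(n : ℝ) * h| p q : ℝ) : ℂ) * a n)] at this
  have hA0 : 0 ≤ A := (norm_nonneg _).trans (ha 0)
  have habs : ∀ n : ℤ, |(n : ℝ) * h| = |(n : ℝ)| * h := fun n => by rw [abs_mul, abs_of_pos hh]
  have hterm : ∀ n : ℤ, ‖w n - smoothWindow p q ((n * h : ℝ) : ℂ) * a n‖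
      ≤ Real.exp (-q ^ 2) * B * A * (1 / (1 + (n : ℝ) ^ 2)) := by
    intro n
    have hn1 : 0 < 1 + (n : ℝ) ^ 2 := by positivity
    suffices hsuff : ∃ g : ℂ, w n - smoothWindow p q ((n * h : ℝ) : ℂ) * a n = g * a n ∧
        ‖g‖ ≤ Real.exp (-q ^ 2) * (B / (1 + (n : ℝ) ^ 2)) by
      obtain ⟨g, hg, hgle⟩ := hsuff
      rw [hg, norm_mul]
      refine (mul_le_mul hgle (ha n) (norm_nonneg _) (by positivity)).trans (le_of_eq (by ring))
    by_cases hn : n ∈ s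
    · refine ⟨gaussTail (((|(n : ℝ) * h| : ℝ) : ℂ) / p + q), ?_, ?_⟩
      · simp only [hw, if_pos hn]
        rw [← sub_mul, window_sub_smoothWindow]
      · have h1 := norm_gaussTail_add_le hp hq.le (t := ((|(n : ℝ) * h| : ℝ) : ℂ))
          (by rw [ofReal_re]; exact abs_nonneg _)
        rw [ofReal_im, ofReal_re] at h1
        have h2 : Real.exp ((0 / p) ^ 2 - (|(n : ℝ) * h| / p + q) ^ 2) ≤ Real.exp (-q ^ 2) := by
          have : 0 ≤ |(n : ℝ) * h| / p := by positivity
          refine Real.exp_le_exp.2 ?_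
          rw [zero_div]
          nlinarith
        refine (h1.trans h2).trans (le_mul_of_one_le_right (Real.exp_pos _).le ?_)
        rw [one_le_div hn1, hB]
        have h3 : (n : ℝ) ^ 2 ≤ (N + 1 : ℝ) ^ 2 := by
          rw [hs, Finset.mem_Icc] at hn
          have e1 : (-(N : ℝ) - 1) ≤ n := by exact_mod_cast hn.1
          have e2 : (n : ℝ) ≤ N := by exact_mod_cast hn.2
          nlinarith
        have : 0 ≤ 2 * (1 + 2 / (h ^ 2 / p ^ 2) ^ 2) := by positivity
        linarith
    · refine ⟨-smoothWindow p q ((n * h : ℝ) : ℂ), by simp only [hw, if_neg hn]; ring, ?_⟩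
      have hn' : (N : ℝ) + 1 ≤ |(n : ℝ)| := by
        rw [hs, Finset.mem_Icc, not_and_or, not_le, not_le] at hn
        have : (N : ℤ) + 1 ≤ |n| := by
          rcases hn with hn | hn
          · have := neg_le_abs n; omega
          · have := le_abs_self n; omega
        exact_mod_cast this
      have hge : p * q ≤ |(((n * h : ℝ) : ℂ)).re| := by
        rw [ofReal_re, habs]
        nlinarith
      rw [norm_neg]
      refine (norm_smoothWindow_le_of_le_re hp hq.le hge).trans ?_
      rw [ofReal_re, ofReal_im, habs]
      have h1 : Real.exp ((0 / p) ^ 2 - (|(n : ℝ)| * h / p - q) ^ 2)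
          ≤ Real.exp (-q ^ 2) * Real.exp (-(h ^ 2 / p ^ 2 * |(n : ℝ)|)) := by
        rw [← Real.exp_add]
        refine Real.exp_le_exp.2 ?_
        -- With `y = |n| h / p` and `N h / p = 2 q` one has
        -- `(y - q) ^ 2 = q ^ 2 + y * (y - 2 * q)` and `y - 2 * q ≥ h / p`.
        have e1 : 2 * q + h / p ≤ |(n : ℝ)| * h / p := by
          have : (N + 1) * h / p = 2 * q + h / p := by
            rw [add_mul, hN]
            field_simp
          rw [← this]
          gcongr
        have e2 : h ^ 2 / p ^ 2 * |(n : ℝ)| = |(n : ℝ)| * h / p * (h / p) := by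
          field_simp
        rw [e2, zero_div]
        have e3 : 0 ≤ |(n : ℝ)| * h / p := by positivity
        nlinarith
      have h2 := exp_neg_mul_abs_le (κ := h ^ 2 / p ^ 2) (by positivity) (n : ℝ)
      calc _ ≤ 2 * (Real.exp (-q ^ 2) * Real.exp (-(h ^ 2 / p ^ 2 * |(n : ℝ)|))) := by gcongr
        _ ≤ 2 * (Real.exp (-q ^ 2) * ((1 + 2 / (h ^ 2 / p ^ 2) ^ 2) / (1 + (n : ℝ) ^ 2))) := by
          gcongr
        _ = Real.exp (-q ^ 2) * (2 * (1 + 2 / (h ^ 2 / p ^ 2) ^ 2) / (1 + (n : ℝ) ^ 2)) := by ring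
        _ ≤ _ := by
          rw [hB]
          gcongr
          have : 0 ≤ 1 + (N + 1 : ℝ) ^ 2 := by positivity
          linarith
  have hsum := summable_one_div_one_add_int_sq.mul_left (Real.exp (-q ^ 2) * B * A)
  have hdiff : Summable fun n : ℤ => w n - smoothWindow p q ((n * h : ℝ) : ℂ) * a n :=
    .of_norm_bounded hsum hterm
  have hW : Summable fun n : ℤ => smoothWindow p q ((n * h : ℝ) : ℂ) * a n := by
    simpa using hws.summable.sub hdiff
  rw [← hws.tsum_eq, ← hws.summable.tsum_sub hW, ← tsum_mul_left]
  exact tsum_of_norm_bounded hsum.hasSum hterm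

/-- The exact representation of the normalizing constant as an absolutely convergent contour
integral. -/
theorem normConst_eq_contourIntegral (γ : Fin m → ℝ) (hm : 1 ≤ m) (hd : 0 < d)
    (hθ : ∀ i, d ≤ θ i - t₀) :
    (normConst θ γ : ℂ) = ((Real.pi ^ ((m : ℝ) / 2 - 1) * Real.exp (-t₀) : ℝ) : ℂ)
      * contourIntegral θ γ t₀ d fun _ => 1 := by
  have h := contourIntegral_one γ hm hd hθ
  have hpi := Real.pi_pos
  have h1 : (Real.pi : ℂ) ^ ((m : ℂ) / 2) = ((Real.pi ^ ((m : ℝ) / 2 - 1) * Real.pi : ℝ) : ℂ) := by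
    rw [Real.rpow_sub_one hpi.ne', div_mul_cancel₀ _ hpi.ne', ofReal_cpow hpi.le]
    push_cast
    rfl
  have h2 : (Real.exp (-t₀) : ℂ) * (Real.exp t₀ : ℂ) = 1 := by
    rw [← ofReal_mul, ← Real.exp_add, neg_add_cancel, Real.exp_zero, ofReal_one]
  have hpi' : (Real.pi : ℂ) ≠ 0 := by exact_mod_cast hpi.ne'
  rw [h1] at h
  refine mul_left_cancel₀ hpi' ?_
  calc (Real.pi : ℂ) * normConst θ γ
      = (Real.exp (-t₀) : ℂ) * (Real.pi * (Real.exp t₀ * normConst θ γ : ℝ)) := by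
        rw [ofReal_mul]
        linear_combination (-(Real.pi : ℂ) * normConst θ γ) * h2
    _ = _ := by
        rw [← h]
        push_cast
        ring

/-- The error of the truncated sum for general mesh size and window parameters, as the sum of three
contributions: the window, the discretization, and the truncation. -/
theorem norm_normConst_sub_eulerSum_le (γ : Fin m → ℝ) (hm : 1 ≤ m) (hd : 0 < d)
    (hθ : ∀ i, d ≤ θ i - t₀) {p q ω R h : ℝ} {N : ℕ} (hp : 0 < p) (hω : 0 < ω) (hω1 : ω ≤ 1)
    (hq : q = ω * p / 2) (hR : R ≤ 2 / 3 * q ^ 2) (hh : 0 < h) (hRh : Real.pi * d / h = R)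
    (hN : N * h = 2 * p * q) :
    ‖(normConst θ γ : ℂ) - eulerSum θ γ t₀ h p q N‖
      ≤ Real.pi ^ ((m : ℝ) / 2 - 1) * Real.exp (-t₀) *
        (Real.pi * (2 * (Real.exp (-R) * (23 / d ^ 2 + 2 * Real.exp (9 / 25 * d ^ 2 / p ^ 2)
          * (1 + 25 * p ^ 2 / d ^ 2))) * amplitudeBound γ d * d)
        + 2 * (Real.pi * (((1 + p ^ 2 * q ^ 2) + 2 * (Real.exp ((d / 2) ^ 2 / p ^ 2)
          * (1 + 2 * p ^ 2 * q ^ 2 + 2 * p ^ 2))) * amplitudeBound γ d * Real.exp (d / 2)))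
          * (Real.exp (-R) / (1 - Real.exp (-R)))
        + h * (Real.exp (-q ^ 2) * (1 + (N + 1 : ℝ) ^ 2 + 2 * (1 + 2 / (h ^ 2 / p ^ 2) ^ 2))
          * amplitudeBound γ d * ∑' n : ℤ, 1 / (1 + (n : ℝ) ^ 2))) := by
  have hq0 : 0 < q := by rw [hq]; positivity
  set a : ℤ → ℂ := fun n => amplitude θ γ t₀ (n * h) * cexp (-I * ((n * h : ℝ) : ℂ)) with ha
  have haA : ∀ n, ‖a n‖ ≤ amplitudeBound γ d := fun n => by
    have h1 : ‖amplitude θ γ t₀ (n * h)‖ ≤ amplitudeBound γ d :=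
      norm_complexAmplitude_le (t := ((n * h : ℝ) : ℂ)) (by positivity) fun i =>
        (amplitude_base_of_abs_im_le hd hθ (by rw [ofReal_im, abs_zero]; positivity) i).2
    simp only [ha]
    rw [norm_mul, norm_cexp_neg_I_mul, ofReal_im, Real.exp_zero, mul_one]
    exact h1
  have e1 := norm_contourIntegral_sub_le γ hd hθ hp hω hω1 hq hR
  have e2 := norm_trapezoidal_sub_contourIntegral_le γ hd hθ hp hq0.le hh
  rw [hRh] at e2
  have e3 := norm_sum_window_sub_tsum_le hp hq0 hh hN haA
  set L1 := contourIntegral θ γ t₀ d fun _ => 1 with hL1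
  set LW := contourIntegral θ γ t₀ d (smoothWindow p q) with hLW
  set S := ∑ n ∈ Finset.Icc (-(N : ℤ) - 1) (N : ℤ),
    ((window |(n : ℝ) * h| p q : ℝ) : ℂ) * a n with hS
  set T := ∑' n : ℤ, smoothWindow p q ((n * h : ℝ) : ℂ) * a n with hT
  set P : ℝ := Real.pi ^ ((m : ℝ) / 2 - 1) * Real.exp (-t₀) with hP
  have hP0 : 0 ≤ P := by have := Real.pi_pos; positivity
  have hsum : eulerSum θ γ t₀ h p q N = (P : ℂ) * (h * S) := by
    rw [eulerSum, hS, hP]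
    simp only [ha, mul_assoc, ofReal_mul]
  have hsplit : (normConst θ γ : ℂ) - eulerSum θ γ t₀ h p q N
      = P * ((L1 - LW) - (h * T - LW) - h * (S - T)) := by
    rw [hsum, normConst_eq_contourIntegral γ hm hd hθ]
    ring
  rw [hsplit, norm_mul, norm_real, Real.norm_of_nonneg hP0]
  refine mul_le_mul_of_nonneg_left ?_ hP0
  refine (norm_sub_le _ _).trans (add_le_add ((norm_sub_le _ _).trans (add_le_add e1 e2)) ?_)
  rw [norm_mul, norm_real, Real.norm_of_nonneg hh.le]
  exact mul_le_mul_of_nonneg_left e3 hh.le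

/-! ### Polynomial dependence on `N` -/

/-- The parameters enter the error bound polynomially in `N`, as soon as `N * h ^ 2 = D` is fixed
and `p`, `q` are expressed through `N * h`. -/
theorem exists_polynomial_bound (γ : Fin m → ℝ) (hm : 1 ≤ m) (hd : 0 < d)
    (hθ : ∀ i, d ≤ θ i - t₀) {ω D : ℝ} (hω : 0 < ω) (hω1 : ω ≤ 1) (hD : 0 < D) :
    ∃ K : ℝ, ∀ (N : ℕ) (h p q R : ℝ), 1 ≤ N → 0 < h → 0 < p → N * h ^ 2 = D →
      p ^ 2 = N * h / ω → q = ω * p / 2 → Real.pi * d / h = R → R ≤ 2 / 3 * q ^ 2 →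
      ‖(normConst θ γ : ℂ) - eulerSum θ γ t₀ h p q N‖ ≤ K * N ^ 3 * Real.exp (-R) := by
  set A := amplitudeBound γ d with hA
  have hA0 : 0 ≤ A := amplitudeBound_nonneg γ hd
  set h₁ := Real.sqrt D with hh₁
  have hh₁0 : 0 < h₁ := Real.sqrt_pos.2 hD
  set s := h₁ / ω with hs
  have hs0 : 0 < s := by positivity
  set G := 1 / (1 - Real.exp (-(Real.pi * d / h₁))) with hG
  set Z := ∑' n : ℤ, 1 / (1 + (n : ℝ) ^ 2) with hZ
  have hZ0 : 0 ≤ Z := tsum_nonneg fun n => by positivity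
  have hpi := Real.pi_pos
  set P : ℝ := Real.pi ^ ((m : ℝ) / 2 - 1) * Real.exp (-t₀) with hP
  have hP0 : 0 ≤ P := by positivity
  set K₁ := Real.pi * (2 * (23 / d ^ 2 + 2 * Real.exp (9 / 25 * d ^ 2 / s)
    * (1 + 25 * s / d ^ 2)) * A * d) with hK₁
  set K₂ := 2 * (Real.pi * (((1 + D / 4) + 2 * (Real.exp ((d / 2) ^ 2 / s)
    * (1 + D / 2 + 2 * s))) * A * Real.exp (d / 2))) * G with hK₂
  set K₃ := h₁ * ((7 + 4 / (ω ^ 2 * D)) * A * Z) with hK₃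
  refine ⟨P * (K₁ + K₂ + K₃), fun N h p q R hN hh hp hNh hp2 hq hR hRq => ?_⟩
  have hN1 : (1 : ℝ) ≤ N := by exact_mod_cast hN
  have hN0 : (0 : ℝ) < N := by linarith
  have hNN : (N : ℝ) ≤ N ^ 3 := by
    simpa using pow_le_pow_right₀ hN1 (by norm_num : 1 ≤ 3)
  have hhle : h ≤ h₁ := by
    refine Real.le_sqrt_of_sq_le ?_
    rw [← hNh]
    exact le_mul_of_one_le_left (by positivity) hN1
  have hgeNh : h₁ ≤ N * h := by
    refine Real.sqrt_le_iff.2 ⟨by positivity, ?_⟩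
    rw [mul_pow, sq (N : ℝ), mul_assoc, hNh]
    exact le_mul_of_one_le_left hD.le hN1
  have hpge : s ≤ p ^ 2 := by
    rw [hp2, hs]
    gcongr
  have hple : p ^ 2 ≤ N * s := by
    rw [hp2, hs, ← mul_div_assoc]
    gcongr
  have hpq : p ^ 2 * q ^ 2 = N * (D / 4) := by
    have : p ^ 2 * q ^ 2 = (ω * p ^ 2) ^ 2 / 4 := by rw [hq]; ring
    rw [this, hp2, ← hNh]
    field_simp
  have hNpq : N * h = 2 * p * q := by
    have : 2 * p * q = ω * p ^ 2 := by rw [hq]; ring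
    rw [this, hp2]
    field_simp
  have b2 : 1 + 25 * p ^ 2 / d ^ 2 ≤ N * (1 + 25 * s / d ^ 2) := by
    have : 25 * p ^ 2 / d ^ 2 ≤ 25 * (N * s) / d ^ 2 := by gcongr
    calc 1 + 25 * p ^ 2 / d ^ 2 ≤ N + 25 * (N * s) / d ^ 2 := add_le_add hN1 this
      _ = _ := by ring
  have b4 : 1 + 2 * p ^ 2 * q ^ 2 + 2 * p ^ 2 ≤ N * (1 + D / 2 + 2 * s) := by
    rw [mul_assoc 2, hpq]
    linarith
  have b5 : 1 + p ^ 2 * q ^ 2 ≤ N * (1 + D / 4) := by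
    rw [hpq]
    linarith
  have hexp1 : Real.exp (-(Real.pi * d / h₁)) < 1 := by
    rw [Real.exp_lt_one_iff, neg_lt_zero]
    positivity
  have b6 : Real.exp (-R) / (1 - Real.exp (-R)) ≤ Real.exp (-R) * G := by
    have h1 : Real.exp (-R) ≤ Real.exp (-(Real.pi * d / h₁)) := by
      rw [← hR]
      gcongr
    rw [div_eq_mul_one_div, hG]
    have : 0 < 1 - Real.exp (-(Real.pi * d / h₁)) := by linarith
    gcongr
  have b6' : 0 ≤ Real.exp (-R) / (1 - Real.exp (-R)) := by
    have : Real.exp (-R) ≤ 1 := by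
      rw [Real.exp_le_one_iff, neg_nonpos, ← hR]
      positivity
    exact div_nonneg (Real.exp_pos _).le (by linarith)
  have hG0 : 0 ≤ G := by
    rw [hG]
    have : 0 < 1 - Real.exp (-(Real.pi * d / h₁)) := by linarith
    positivity
  have b7 : 1 + (N + 1 : ℝ) ^ 2 + 2 * (1 + 2 / (h ^ 2 / p ^ 2) ^ 2)
      ≤ N ^ 3 * (7 + 4 / (ω ^ 2 * D)) := by
    have h1 : 2 / (h ^ 2 / p ^ 2) ^ 2 = N ^ 3 * (2 / (ω ^ 2 * D)) := by
      rw [hp2, ← hNh]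
      field_simp
    have h2 : (N : ℝ) ^ 2 ≤ N ^ 3 := pow_le_pow_right₀ hN1 (by norm_num)
    rw [h1]
    have h3 : (N : ℝ) ^ 3 * (7 + 4 / (ω ^ 2 * D))
        = 7 * N ^ 3 + 2 * (N ^ 3 * (2 / (ω ^ 2 * D))) := by ring
    rw [h3, show (N + 1 : ℝ) ^ 2 = N ^ 2 + 2 * N + 1 by ring]
    linarith
  have b8 : Real.exp (-q ^ 2) ≤ Real.exp (-R) :=
    Real.exp_le_exp.2 (by linarith [sq_nonneg q])
  have c1 : Real.pi * (2 * (Real.exp (-R) * (23 / d ^ 2 + 2 * Real.exp (9 / 25 * d ^ 2 / p ^ 2)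
      * (1 + 25 * p ^ 2 / d ^ 2))) * A * d) ≤ K₁ * N ^ 3 * Real.exp (-R) := by
    calc _ ≤ Real.pi * (2 * (Real.exp (-R) * (N * (23 / d ^ 2)
          + 2 * Real.exp (9 / 25 * d ^ 2 / s) * (N * (1 + 25 * s / d ^ 2)))) * A * d) := by
          gcongr
          exact le_mul_of_one_le_left (by positivity) hN1
      _ = K₁ * N * Real.exp (-R) := by rw [hK₁]; ring
      _ ≤ _ := by gcongr
  have c2 : 2 * (Real.pi * (((1 + p ^ 2 * q ^ 2) + 2 * (Real.exp ((d / 2) ^ 2 / p ^ 2)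
      * (1 + 2 * p ^ 2 * q ^ 2 + 2 * p ^ 2))) * A * Real.exp (d / 2)))
      * (Real.exp (-R) / (1 - Real.exp (-R))) ≤ K₂ * N ^ 3 * Real.exp (-R) := by
    calc _ ≤ 2 * (Real.pi * ((N * (1 + D / 4) + 2 * (Real.exp ((d / 2) ^ 2 / s)
          * (N * (1 + D / 2 + 2 * s)))) * A * Real.exp (d / 2))) * (Real.exp (-R) * G) := by
          gcongr
      _ = K₂ * N * Real.exp (-R) := by rw [hK₂]; ring
      _ ≤ _ := by gcongr
  have c3 : h * (Real.exp (-q ^ 2) * (1 + (N + 1 : ℝ) ^ 2 + 2 * (1 + 2 / (h ^ 2 / p ^ 2) ^ 2))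
      * A * Z) ≤ K₃ * N ^ 3 * Real.exp (-R) := by
    calc _ ≤ h₁ * (Real.exp (-R) * (N ^ 3 * (7 + 4 / (ω ^ 2 * D))) * A * Z) := by gcongr
      _ = _ := by rw [hK₃]; ring
  have key := norm_normConst_sub_eulerSum_le γ hm hd hθ hp hω hω1 hq hRq hh hR hNpq
  refine key.trans ?_
  calc _ ≤ P * (K₁ * N ^ 3 * Real.exp (-R) + K₂ * N ^ 3 * Real.exp (-R)
        + K₃ * N ^ 3 * Real.exp (-R)) := by gcongr
    _ = _ := by ring

end

end FisherBingham

theorem theorem2 (m : ℕ) (hm : 1 ≤ m) (θ γ : Fin m → ℝ) (t₀ : ℝ) (ht₀ : ∀ i, t₀ < θ i)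
    (ωd ωu d : ℝ) (hωd : 0 < ωd) (hωd1 : ωd ≤ 1) (hωu1 : 1 ≤ ωu) (hω : ωd / ωu ≤ 1 / 2)
    (hd : 0 < d) (hdθ : ∀ i, d ≤ |θ i - t₀|) :
    ∃ Poly : Polynomial ℝ, ∀ N : ℕ,
      2 * d * (ωd + ωu) * ωu ^ 2 / (Real.pi * ωd ^ 2) ≤ (N : ℝ) →
      ‖(FisherBingham.normConst θ γ : ℂ)
          - FisherBingham.eulerSum θ γ t₀ (FisherBingham.stepSize ωd ωu d N)
              (FisherBingham.windowP ωd (FisherBingham.stepSize ωd ωu d N) N)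
              (FisherBingham.windowQ ωd (FisherBingham.stepSize ωd ωu d N) N) N‖
        ≤ Poly.eval (N : ℝ)
          * Real.exp (-Real.sqrt (Real.pi * d * ωd ^ 2 * N / (2 * (ωd + ωu)))) := by
  have hpi := Real.pi_pos
  have hωu : 0 < ωu := by linarith
  have hθ : ∀ i, d ≤ θ i - t₀ := fun i => by
    have := hdθ i
    rwa [abs_of_pos (by linarith [ht₀ i])] at this
  have h2ω : 2 * ωd ≤ ωu := by
    rw [div_le_iff₀ hωu] at hω
    linarith
  obtain ⟨K, hK⟩ := FisherBingham.exists_polynomial_bound γ hm hd hθ hωd hωd1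
    (D := 2 * Real.pi * d * (ωd + ωu) / ωd ^ 2) (by positivity)
  refine ⟨Polynomial.C K * Polynomial.X ^ 3, fun N hN => ?_⟩
  have hN0 : (0 : ℝ) < N := lt_of_lt_of_le (by positivity) hN
  have hN1 : 1 ≤ N := Nat.one_le_iff_ne_zero.2 fun h => by simp [h] at hN0
  set h := FisherBingham.stepSize ωd ωu d N with hh
  have hh0 : 0 < h := by
    rw [hh, FisherBingham.stepSize]
    positivity
  have hh2 : h ^ 2 = 2 * Real.pi * d * (ωd + ωu) / (ωd ^ 2 * N) := by
    rw [hh, FisherBingham.stepSize, Real.sq_sqrt (by positivity)]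
  have hp0 : 0 < FisherBingham.windowP ωd h N := by
    rw [FisherBingham.windowP]
    positivity
  have hp2 : FisherBingham.windowP ωd h N ^ 2 = N * h / ωd := by
    rw [FisherBingham.windowP, Real.sq_sqrt (by positivity)]
  have hq : FisherBingham.windowQ ωd h N = ωd * FisherBingham.windowP ωd h N / 2 := by
    rw [FisherBingham.windowQ, Real.sqrt_eq_iff_eq_sq (by positivity) (by positivity), div_pow,
      mul_pow, hp2]
    field_simp
    norm_num
  have hR : Real.pi * d / h = Real.sqrt (Real.pi * d * ωd ^ 2 * N / (2 * (ωd + ωu))) := by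
    rw [eq_comm, Real.sqrt_eq_iff_eq_sq (by positivity) (by positivity), div_pow, hh2]
    field_simp
  have hRq : Real.sqrt (Real.pi * d * ωd ^ 2 * N / (2 * (ωd + ωu)))
      ≤ 2 / 3 * FisherBingham.windowQ ωd h N ^ 2 := by
    rw [← hR, hq, div_pow, mul_pow, hp2, div_le_iff₀ hh0]
    have : 2 / 3 * (ωd ^ 2 * (N * h / ωd) / 2 ^ 2) * h = Real.pi * d * ((ωd + ωu) / (3 * ωd)) := by
      calc _ = ωd * N / 6 * h ^ 2 := by field_simp; norm_num
        _ = _ := by rw [hh2]; field_simp; norm_num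
    rw [this]
    refine le_mul_of_one_le_right (by positivity) ?_
    rw [one_le_div (by positivity)]
    linarith
  have := hK N h _ _ _ hN1 hh0 hp0 (by rw [hh2]; field_simp) hp2 hq hR hRq
  simpa using this
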